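/- Let $\ell>0$ and let $\rho,\sigma\in H^2(0,\ell)$ and $q\in H^1(0,\ell)$ be real-valued, with constants $\rho_0,\sigma_0>0$ such that $\rho(x)\ge\rho_0$, $\sigma(x)\ge\sigma_0$ and $q(x)\ge 0$ for all $x\in[0,\ell]$. Consider the spectral problem $$(\sigma\phi'')''-(q\phi')'=\lambda\rho\,\phi\ \text{ on }(0,\ell),\qquad \phi(0)=\phi'(0)=\phi(\ell)=\phi'(\ell)=0,$$ for complex-valued $\phi\in H^4(0,\ell)$ and $\lambda\in\mathbb C$; equivalently, the eigenvalue problem $\mathcal A\phi=\lambda\phi$ for the operator $\mathcal A y=\rho^{-1}\big((\sigma y'')''-(qy')'\big)$ in $L^2_\rho(0,\ell)=L^2((0,\ell),\rho\,dx)$ with domain $H^4(0,\ell)\cap H^2_0(0,\ell)$. Then all eigenvalues are real and simple, geometrically and algebraically (that is, $\dim\ker(\mathcal A-\lambda)=\dim\bigcup_{k\ge1}\ker(\mathcal A-\lambda)^k=1$ for each eigenvalue $\lambda$), and the set of all eigenvalues is a sequence $$0<\lambda_1<\lambda_2<\dots<\lambda_n<\dots\xrightarrow[n\to\infty]{}+\infty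 .$$ Moreover, for every $n\ge1$, every eigenfunction $\Phi_n$ associated with $\lambda_n$ satisfies $\Phi_n''(\ell)\neq0$. -/

import Mathlib

open MeasureTheory Set

noncomputable section

namespace ClampedBeam

/-- `g` is the weak derivative of `f` on `(0,ℓ)`, both being in `L²(0,ℓ)`:
`∫ φ' f = - ∫ φ g` for all smooth test functions `φ` with compact support in `(0,ℓ)`. -/
structure HasWeakDeriv {E : Type*} [NormedAddCommGroup E] [NormedSpace ℝ E]
    (ℓ : ℝ) (f g : ℝ → E) : Prop where
  memLp_fun : MemLp f 2 (volume.restrict (Ioo 0 ℓ))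
  memLp_deriv : MemLp g 2 (volume.restrict (Ioo 0 ℓ))
  integral_eq : ∀ φ : ℝ → ℝ, ContDiff ℝ (⊤ : ℕ∞) φ → HasCompactSupport φ →
    tsupport φ ⊆ Ioo 0 ℓ →
    ∫ x in Ioo 0 ℓ, deriv φ x • f x = - ∫ x in Ioo 0 ℓ, φ x • g x

/-- Membership in the Sobolev space `H^k(0,ℓ)`. -/
def MemH {E : Type*} [NormedAddCommGroup E] [NormedSpace ℝ E] (ℓ : ℝ) :
    ℕ → (ℝ → E) → Prop
  | 0, f => MemLp f 2 (volume.restrict (Ioo 0 ℓ))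
  | k + 1, f => ∃ g, HasWeakDeriv ℓ f g ∧ MemH ℓ k g

/-- `u ∈ H⁴(0,ℓ) ∩ H²₀(0,ℓ)`, given by its `C³([0,ℓ])` representative. -/
structure MemDomain (ℓ : ℝ) (u : ℝ → ℂ) : Prop where
  memH : MemH ℓ 4 u
  contDiffOn : ContDiffOn ℝ 3 u (Icc 0 ℓ)
  left : u 0 = 0
  deriv_left : derivWithin u (Icc 0 ℓ) 0 = 0
  right : u ℓ = 0
  deriv_right : derivWithin u (Icc 0 ℓ) ℓ = 0

/-- `u ∈ H⁴(0,ℓ) ∩ H²₀(0,ℓ)` and `(σ u'')'' - (q u')' = g` almost everywhere on `(0,ℓ)`. Here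
`m₁ = (σ u'')'`, `m₂ = (σ u'')''` and `p₁ = (q u')'` are weak derivatives. -/
def SolvesClamped (ℓ : ℝ) (σ q : ℝ → ℝ) (u g : ℝ → ℂ) : Prop :=
  MemDomain ℓ u ∧
  ∃ m₁ m₂ p₁ : ℝ → ℂ,
    HasWeakDeriv ℓ (fun x => σ x • iteratedDerivWithin 2 u (Icc 0 ℓ) x) m₁ ∧
    HasWeakDeriv ℓ m₁ m₂ ∧
    HasWeakDeriv ℓ (fun x => q x • derivWithin u (Icc 0 ℓ) x) p₁ ∧
    ∀ᵐ x ∂volume.restrict (Ioo 0 ℓ), m₂ x - p₁ x = g x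

/-- `Φ` is an eigenfunction, for the parameter `z`, of the problem
`(σ φ'')'' - (q φ')' = z ρ φ`, `φ(0) = φ'(0) = φ(ℓ) = φ'(ℓ) = 0`. -/
def IsEigenfunction (ℓ : ℝ) (σ q ρ : ℝ → ℝ) (z : ℂ) (Φ : ℝ → ℂ) : Prop :=
  SolvesClamped ℓ σ q Φ (fun x => z * (ρ x : ℂ) * Φ x) ∧ ∃ x ∈ Icc 0 ℓ, Φ x ≠ 0

/-- `z` is an eigenvalue of the clamped problem. -/
def IsEigenvalue (ℓ : ℝ) (σ q ρ : ℝ → ℝ) (z : ℂ) : Prop :=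
  ∃ Φ : ℝ → ℂ, IsEigenfunction ℓ σ q ρ z Φ

/-- The measure `ρ(x) dx` on `(0,ℓ)`. -/
def weight (ℓ : ℝ) (ρ : ℝ → ℝ) : Measure ℝ :=
  (volume.restrict (Ioo 0 ℓ)).withDensity (fun x => ENNReal.ofReal (ρ x))

/-- The space `L²_ρ(0,ℓ)` of complex functions. -/
abbrev L2w (ℓ : ℝ) (ρ : ℝ → ℝ) : Type := Lp ℂ 2 (weight ℓ ρ)

section Closure

variable {E : Type*} [NormedAddCommGroup E] [NormedSpace ℝ E] {ℓ : ℝ}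

lemma integrable_smul_of_memLp {φ : ℝ → ℝ} (hφ : Continuous φ) (hc : HasCompactSupport φ)
    {f : ℝ → E} (hf : MemLp f 2 (volume.restrict (Ioo 0 ℓ))) :
    Integrable (fun x => φ x • f x) (volume.restrict (Ioo 0 ℓ)) := by
  have h1 : Integrable f (volume.restrict (Ioo 0 ℓ)) := hf.integrable (by norm_num)
  obtain ⟨C, hC⟩ := hc.exists_bound_of_continuous hφ
  exact h1.bdd_smul C hφ.aestronglyMeasurable (Filter.Eventually.of_forall hC)

lemma HasWeakDeriv.add {f g f' g' : ℝ → E} (h : HasWeakDeriv ℓ f g)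
    (h' : HasWeakDeriv ℓ f' g') : HasWeakDeriv ℓ (f + f') (g + g') := by
  refine ⟨h.1.add h'.1, h.2.add h'.2, fun φ hφ hc hs => ?_⟩
  have hd : Continuous (deriv φ) := hφ.continuous_deriv (by simp)
  simp only [Pi.add_apply, smul_add]
  rw [integral_add (integrable_smul_of_memLp hd hc.deriv h.1)
      (integrable_smul_of_memLp hd hc.deriv h'.1),
    integral_add (integrable_smul_of_memLp hφ.continuous hc h.2)
      (integrable_smul_of_memLp hφ.continuous hc h'.2),
    h.3 φ hφ hc hs, h'.3 φ hφ hc hs, neg_add]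

lemma HasWeakDeriv.const_smul {f g : ℝ → ℂ} (h : HasWeakDeriv ℓ f g) (c : ℂ) :
    HasWeakDeriv ℓ (c • f) (c • g) := by
  refine ⟨h.1.const_smul c, h.2.const_smul c, fun φ hφ hc hs => ?_⟩
  simp only [Pi.smul_apply, smul_comm _ c]
  rw [integral_smul, integral_smul, h.3 φ hφ hc hs, smul_neg]

lemma HasWeakDeriv.congr {f g f' : ℝ → E} (h : HasWeakDeriv ℓ f g)
    (hf : EqOn f' f (Ioo 0 ℓ)) : HasWeakDeriv ℓ f' g := by
  refine ⟨h.1.ae_eq ?_, h.2, fun φ hφ hc hs => ?_⟩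
  · exact (ae_restrict_of_forall_mem measurableSet_Ioo fun x hx => (hf hx).symm)
  · rw [← h.3 φ hφ hc hs]
    exact setIntegral_congr_fun measurableSet_Ioo fun x hx => by simp only [hf hx]

lemma MemH.add : ∀ {k : ℕ} {f g : ℝ → E}, MemH ℓ k f → MemH ℓ k g → MemH ℓ k (f + g)
  | 0, _, _, hf, hg => MemLp.add hf hg
  | _ + 1, _, _, ⟨f', hf, hf'⟩, ⟨g', hg, hg'⟩ => ⟨f' + g', hf.add hg, MemH.add hf' hg'⟩

lemma MemH.const_smul (c : ℂ) : ∀ {k : ℕ} {f : ℝ → ℂ}, MemH ℓ k f → MemH ℓ k (c • f)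
  | 0, _, hf => MemLp.const_smul hf c
  | _ + 1, _, ⟨f', hf, hf'⟩ => ⟨c • f', hf.const_smul c, MemH.const_smul c hf'⟩

lemma MemDomain.differentiableWithinAt {u : ℝ → ℂ} (h : MemDomain ℓ u) {x : ℝ}
    (hx : x ∈ Icc 0 ℓ) : DifferentiableWithinAt ℝ u (Icc 0 ℓ) x :=
  h.contDiffOn.differentiableOn (by norm_num) x hx

lemma MemDomain.contDiffWithinAt {u : ℝ → ℂ} (h : MemDomain ℓ u) {x : ℝ}
    (hx : x ∈ Icc 0 ℓ) : ContDiffWithinAt ℝ (2 : ℕ) u (Icc 0 ℓ) x :=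
  (h.contDiffOn x hx).of_le (by norm_num)

lemma MemDomain.add (hℓ : 0 < ℓ) {u v : ℝ → ℂ} (hu : MemDomain ℓ u) (hv : MemDomain ℓ v) :
    MemDomain ℓ (u + v) := by
  have h0 : (0 : ℝ) ∈ Icc 0 ℓ := ⟨le_rfl, hℓ.le⟩
  have h1 : ℓ ∈ Icc 0 ℓ := ⟨hℓ.le, le_rfl⟩
  refine ⟨hu.1.add hv.1, hu.2.add hv.2, ?_, ?_, ?_, ?_⟩
  · simp [hu.left, hv.left]
  · rw [derivWithin_add (hu.differentiableWithinAt h0) (hv.differentiableWithinAt h0),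
      hu.deriv_left, hv.deriv_left, add_zero]
  · simp [hu.right, hv.right]
  · rw [derivWithin_add (hu.differentiableWithinAt h1) (hv.differentiableWithinAt h1),
      hu.deriv_right, hv.deriv_right, add_zero]

lemma MemDomain.const_smul (hℓ : 0 < ℓ) {u : ℝ → ℂ} (hu : MemDomain ℓ u) (c : ℂ) :
    MemDomain ℓ (c • u) := by
  have h0 : (0 : ℝ) ∈ Icc 0 ℓ := ⟨le_rfl, hℓ.le⟩
  have h1 : ℓ ∈ Icc 0 ℓ := ⟨hℓ.le, le_rfl⟩
  refine ⟨hu.1.const_smul c, hu.2.const_smul c, ?_, ?_, ?_, ?_⟩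
  · simp [hu.left]
  · rw [derivWithin_const_smul c (hu.differentiableWithinAt h0), hu.deriv_left, smul_zero]
  · simp [hu.right]
  · rw [derivWithin_const_smul c (hu.differentiableWithinAt h1), hu.deriv_right, smul_zero]

lemma SolvesClamped.add (hℓ : 0 < ℓ) {σ q : ℝ → ℝ} {u v g h : ℝ → ℂ}
    (hu : SolvesClamped ℓ σ q u g) (hv : SolvesClamped ℓ σ q v h) :
    SolvesClamped ℓ σ q (u + v) (g + h) := by
  obtain ⟨du, m₁, m₂, p₁, hm₁, hm₂, hp₁, e⟩ := hu
  obtain ⟨dv, m₁', m₂', p₁', hm₁', hm₂', hp₁', e'⟩ := hv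
  refine ⟨du.add hℓ dv, m₁ + m₁', m₂ + m₂', p₁ + p₁', (hm₁.add hm₁').congr ?_, hm₂.add hm₂',
    (hp₁.add hp₁').congr ?_, ?_⟩
  · intro x hx
    have hx' := Ioo_subset_Icc_self hx
    simp only [Pi.add_apply]
    rw [iteratedDerivWithin_add hx' (uniqueDiffOn_Icc hℓ) (du.contDiffWithinAt hx')
      (dv.contDiffWithinAt hx'), smul_add]
  · intro x hx
    have hx' := Ioo_subset_Icc_self hx
    simp only [Pi.add_apply]
    rw [derivWithin_add (du.differentiableWithinAt hx') (dv.differentiableWithinAt hx'), smul_add]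
  · filter_upwards [e, e'] with x hx hx'
    simp only [Pi.add_apply, ← hx, ← hx']
    ring

lemma SolvesClamped.const_smul (hℓ : 0 < ℓ) {σ q : ℝ → ℝ} {u g : ℝ → ℂ}
    (hu : SolvesClamped ℓ σ q u g) (c : ℂ) : SolvesClamped ℓ σ q (c • u) (c • g) := by
  obtain ⟨du, m₁, m₂, p₁, hm₁, hm₂, hp₁, e⟩ := hu
  refine ⟨du.const_smul hℓ c, c • m₁, c • m₂, c • p₁, (hm₁.const_smul c).congr ?_,
    hm₂.const_smul c, (hp₁.const_smul c).congr ?_, ?_⟩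
  · intro x hx
    have hx' := Ioo_subset_Icc_self hx
    simp only [Pi.smul_apply]
    rw [iteratedDerivWithin_const_smul hx' (uniqueDiffOn_Icc hℓ) c (du.contDiffWithinAt hx'),
      smul_comm]
  · intro x hx
    have hx' := Ioo_subset_Icc_self hx
    simp only [Pi.smul_apply]
    rw [derivWithin_const_smul c (du.differentiableWithinAt hx'), smul_comm]
  · filter_upwards [e] with x hx
    simp only [Pi.smul_apply, ← hx, smul_sub]

lemma hasWeakDeriv_zero : HasWeakDeriv ℓ (0 : ℝ → E) 0 :=
  ⟨MemLp.zero, MemLp.zero, fun φ _ _ _ => by simp⟩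

lemma memH_zero : ∀ k : ℕ, MemH ℓ k (0 : ℝ → E)
  | 0 => MemLp.zero
  | k + 1 => ⟨0, hasWeakDeriv_zero, memH_zero k⟩

lemma solvesClamped_zero (σ q : ℝ → ℝ) : SolvesClamped ℓ σ q 0 0 := by
  refine ⟨⟨memH_zero 4, contDiffOn_const, rfl, ?_, rfl, ?_⟩, 0, 0, 0, ?_, hasWeakDeriv_zero,
    ?_, ?_⟩
  · exact congrFun (derivWithin_const (Icc 0 ℓ) (0 : ℂ)) 0
  · exact congrFun (derivWithin_const (Icc 0 ℓ) (0 : ℂ)) ℓ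
  · refine hasWeakDeriv_zero.congr fun x _ => ?_
    have : iteratedDerivWithin 2 (0 : ℝ → ℂ) (Icc 0 ℓ) x = 0 := by
      exact (iteratedDerivWithin_const (n := 2) (s := Icc 0 ℓ) (c := (0 : ℂ)) (x := x)).trans
        (if_neg two_ne_zero)
    simp [this]
  · refine hasWeakDeriv_zero.congr fun x _ => ?_
    have : derivWithin (0 : ℝ → ℂ) (Icc 0 ℓ) x = 0 :=
      congrFun (derivWithin_const (Icc 0 ℓ) (0 : ℂ)) x
    simp [this]
  · simp

end Closure

/-- The graph of the unbounded operator `𝒜 y = ρ⁻¹ ((σ y'')'' - (q y')')` in `L²_ρ(0,ℓ)` with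
domain `H⁴(0,ℓ) ∩ H²₀(0,ℓ)`: the pairs `(y, f)` with `y` in the domain and
`(σ y'')'' - (q y')' = ρ f`. -/
def opGraph {ℓ : ℝ} (hℓ : 0 < ℓ) (σ q ρ : ℝ → ℝ) : Submodule ℂ (L2w ℓ ρ × L2w ℓ ρ) where
  carrier := {p | ∃ u f : ℝ → ℂ, p.1 =ᵐ[weight ℓ ρ] u ∧ p.2 =ᵐ[weight ℓ ρ] f ∧
    SolvesClamped ℓ σ q u (fun x => (ρ x : ℂ) * f x)}
  add_mem' := by
    rintro p p' ⟨u, f, hu, hf, h⟩ ⟨u', f', hu', hf', h'⟩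
    refine ⟨u + u', f + f', (Lp.coeFn_add _ _).trans (hu.add hu'),
      (Lp.coeFn_add _ _).trans (hf.add hf'), ?_⟩
    convert h.add hℓ h' using 1
    ext x
    simp [mul_add]
  zero_mem' := by
    refine ⟨0, 0, Lp.coeFn_zero _ _ _, Lp.coeFn_zero _ _ _, ?_⟩
    convert solvesClamped_zero σ q using 1
    ext x
    simp
  smul_mem' := by
    rintro c p ⟨u, f, hu, hf, h⟩
    refine ⟨c • u, c • f, (Lp.coeFn_smul _ _).trans (hu.const_smul c),
      (Lp.coeFn_smul _ _).trans (hf.const_smul c), ?_⟩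
    convert h.const_smul hℓ c using 1
    ext x
    simp only [Pi.smul_apply, smul_eq_mul]
    ring

/-- `rootSpace hℓ σ q ρ z k` is the kernel of `(𝒜 - z)^k`: a vector `y` belongs to the kernel of
`(𝒜 - z)^(k+1)` iff it is in the domain of `𝒜` and `w = 𝒜 y - z y` is in that of `(𝒜 - z)^k`. -/
def rootSpace {ℓ : ℝ} (hℓ : 0 < ℓ) (σ q ρ : ℝ → ℝ) (z : ℂ) : ℕ → Submodule ℂ (L2w ℓ ρ)
  | 0 => ⊥
  | k + 1 =>
    { carrier := {y | ∃ w ∈ rootSpace hℓ σ q ρ z k, (y, z • y + w) ∈ opGraph hℓ σ q ρ}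
      add_mem' := by
        rintro y y' ⟨w, hw, h⟩ ⟨w', hw', h'⟩
        refine ⟨w + w', add_mem hw hw', ?_⟩
        convert add_mem h h' using 1
        simp only [Prod.mk_add_mk, smul_add]
        congr 1
        abel
      zero_mem' := ⟨0, zero_mem _, by
        convert zero_mem (opGraph hℓ σ q ρ) using 1
        simp⟩
      smul_mem' := by
        rintro c y ⟨w, hw, h⟩
        refine ⟨c • w, Submodule.smul_mem _ c hw, ?_⟩
        convert Submodule.smul_mem _ c h using 1
        simp only [Prod.smul_mk, smul_add]
        rw [smul_comm] }

/-- The eigenspace `ker (𝒜 - z)`; its dimension is the geometric multiplicity of `z`. -/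
def eigenSpace {ℓ : ℝ} (hℓ : 0 < ℓ) (σ q ρ : ℝ → ℝ) (z : ℂ) : Submodule ℂ (L2w ℓ ρ) :=
  rootSpace hℓ σ q ρ z 1

/-- The root subspace `⋃ₖ ker (𝒜 - z)^k`; its dimension is the algebraic multiplicity of `z`. -/
def genEigenSpace {ℓ : ℝ} (hℓ : 0 < ℓ) (σ q ρ : ℝ → ℝ) (z : ℂ) : Submodule ℂ (L2w ℓ ρ) :=
  ⨆ k, rootSpace hℓ σ q ρ z k

end ClampedBeam

end

noncomputable section

namespace ClampedBeam

variable {ℓ : ℝ}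

/-- `F` is a primitive on `[0,ℓ]` of the square integrable function `f`. -/
structure IsPrim (ℓ : ℝ) (F f : ℝ → ℂ) : Prop where
  memLp : MemLp f 2 (volume.restrict (Ioo 0 ℓ))
  eq : ∀ x ∈ Icc 0 ℓ, F x = F 0 + ∫ t in 0..x, f t

lemma intervalIntegrable_of_memLp {f : ℝ → ℂ} (hf : MemLp f 2 (volume.restrict (Ioo 0 ℓ)))
    {x y : ℝ} (hx : x ∈ Icc 0 ℓ) (hy : y ∈ Icc 0 ℓ) : IntervalIntegrable f volume x y := by
  have h : IntegrableOn f (Ioo 0 ℓ) := hf.integrable (by norm_num)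
  have h0 : IntervalIntegrable f volume 0 ℓ :=
    (intervalIntegrable_iff_integrableOn_Ioo_of_le (hx.1.trans hx.2)).2 h
  refine h0.mono_set ?_
  rw [uIcc_of_le (hx.1.trans hx.2)]
  exact uIcc_subset_Icc hx hy

lemma integral_Ioo_eq (hℓ : 0 < ℓ) (f : ℝ → ℂ) :
    ∫ x in Ioo 0 ℓ, f x = ∫ x in (0 : ℝ)..ℓ, f x := by
  rw [intervalIntegral.integral_of_le hℓ.le, integral_Ioc_eq_integral_Ioo]

/-- The primitive of a square integrable function with value `c` at `0`. -/
lemma isPrim_integral (c : ℂ) {f : ℝ → ℂ}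
    (hf : MemLp f 2 (volume.restrict (Ioo 0 ℓ))) :
    IsPrim ℓ (fun x => c + ∫ t in 0..x, f t) f :=
  ⟨hf, fun x _ => by simp⟩

lemma continuousOn_integral (hℓ : 0 < ℓ) {f : ℝ → ℂ}
    (hf : MemLp f 2 (volume.restrict (Ioo 0 ℓ))) :
    ContinuousOn (fun x => ∫ t in 0..x, f t) (Icc 0 ℓ) := by
  have h := intervalIntegrable_of_memLp hf (left_mem_Icc.2 hℓ.le) (right_mem_Icc.2 hℓ.le)
  have := intervalIntegral.continuousOn_primitive_interval' h left_mem_uIcc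
  rwa [uIcc_of_le hℓ.le] at this

lemma memLp_of_continuousOn {f : ℝ → ℂ} (hf : ContinuousOn f (Icc 0 ℓ)) {p : ENNReal} :
    MemLp f p (volume.restrict (Ioo 0 ℓ)) := by
  obtain ⟨C, hC⟩ := isCompact_Icc.exists_bound_of_continuousOn hf
  refine MemLp.of_bound ((hf.mono Ioo_subset_Icc_self).aestronglyMeasurable measurableSet_Ioo) C ?_
  exact ae_restrict_of_forall_mem measurableSet_Ioo fun x hx => hC x (Ioo_subset_Icc_self hx)

lemma memLp_continuousOn_mul {f g : ℝ → ℂ} (hf : ContinuousOn f (Icc 0 ℓ))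
    (hg : MemLp g 2 (volume.restrict (Ioo 0 ℓ))) :
    MemLp (fun x => f x * g x) 2 (volume.restrict (Ioo 0 ℓ)) :=
  hg.mul (memLp_of_continuousOn hf (p := ⊤))

lemma memLp_mul_continuousOn {f g : ℝ → ℂ} (hf : MemLp f 2 (volume.restrict (Ioo 0 ℓ)))
    (hg : ContinuousOn g (Icc 0 ℓ)) :
    MemLp (fun x => f x * g x) 2 (volume.restrict (Ioo 0 ℓ)) := by
  simpa only [mul_comm] using memLp_continuousOn_mul hg hf

lemma eqOn_Icc_of_ae_eq {f g : ℝ → ℂ}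
    (hf : ContinuousOn f (Icc 0 ℓ)) (hg : ContinuousOn g (Icc 0 ℓ)) (hℓ : 0 < ℓ)
    (h : ∀ᵐ x ∂volume.restrict (Ioo 0 ℓ), f x = g x) : EqOn f g (Icc 0 ℓ) := by
  have h' : f =ᵐ[volume.restrict (Icc 0 ℓ)] g := by
    rwa [← restrict_Ioo_eq_restrict_Icc] at *
  exact Measure.eqOn_Icc_of_ae_eq volume hℓ.ne h' hf hg

namespace IsPrim

variable {F G f g : ℝ → ℂ}

lemma continuousOn (hℓ : 0 < ℓ) (h : IsPrim ℓ F f) : ContinuousOn F (Icc 0 ℓ) :=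
  (continuousOn_const.add (continuousOn_integral hℓ h.memLp)).congr h.eq

lemma sub_eq (h : IsPrim ℓ F f) {x y : ℝ} (hx : x ∈ Icc 0 ℓ) (hy : y ∈ Icc 0 ℓ) :
    F y - F x = ∫ t in x..y, f t := by
  have h0 : (0 : ℝ) ∈ Icc 0 ℓ := left_mem_Icc.2 (hx.1.trans hx.2)
  rw [h.eq x hx, h.eq y hy, add_sub_add_left_eq_sub]
  exact intervalIntegral.integral_interval_sub_left (intervalIntegrable_of_memLp h.memLp h0 hy)
    (intervalIntegrable_of_memLp h.memLp h0 hx)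

lemma congr_left (h : IsPrim ℓ F f) (hG : EqOn G F (Icc 0 ℓ)) : IsPrim ℓ G f := by
  refine ⟨h.memLp, fun x hx => ?_⟩
  rw [hG hx, hG (left_mem_Icc.2 (hx.1.trans hx.2)), h.eq x hx]

lemma congr_right (h : IsPrim ℓ F f) (hg : f =ᵐ[volume.restrict (Ioo 0 ℓ)] g) : IsPrim ℓ F g := by
  refine ⟨h.memLp.ae_eq hg, fun x hx => ?_⟩
  rw [h.eq x hx]
  congr 1
  refine intervalIntegral.integral_congr_ae_restrict ?_
  rw [uIoc_of_le hx.1, ← restrict_Ioo_eq_restrict_Ioc]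
  exact ae_restrict_of_ae_restrict_of_subset (Ioo_subset_Ioo_right hx.2) hg

lemma congr_right_on (h : IsPrim ℓ F f) (hg : EqOn f g (Icc 0 ℓ)) : IsPrim ℓ F g :=
  h.congr_right (ae_restrict_of_forall_mem measurableSet_Ioo
    fun _ hx => hg (Ioo_subset_Icc_self hx))

lemma add (hF : IsPrim ℓ F f) (hG : IsPrim ℓ G g) :
    IsPrim ℓ (fun x => F x + G x) (fun x => f x + g x) := by
  refine ⟨hF.memLp.add hG.memLp, fun x hx => ?_⟩
  have h0 : (0 : ℝ) ∈ Icc 0 ℓ := left_mem_Icc.2 (hx.1.trans hx.2)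
  rw [intervalIntegral.integral_add (intervalIntegrable_of_memLp hF.memLp h0 hx)
    (intervalIntegrable_of_memLp hG.memLp h0 hx), hF.eq x hx, hG.eq x hx]
  ring

lemma const_mul (hF : IsPrim ℓ F f) (c : ℂ) : IsPrim ℓ (fun x => c * F x) (fun x => c * f x) := by
  refine ⟨hF.memLp.const_mul c, fun x hx => ?_⟩
  rw [intervalIntegral.integral_const_mul, hF.eq x hx]
  ring

lemma neg (hF : IsPrim ℓ F f) : IsPrim ℓ (fun x => - F x) (fun x => - f x) := by
  simpa using hF.const_mul (-1)

lemma sub (hF : IsPrim ℓ F f) (hG : IsPrim ℓ G g) :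
    IsPrim ℓ (fun x => F x - G x) (fun x => f x - g x) := by
  simpa only [sub_eq_add_neg] using hF.add hG.neg

lemma conj (hF : IsPrim ℓ F f) :
    IsPrim ℓ (fun x => (starRingEnd ℂ) (F x)) (fun x => (starRingEnd ℂ) (f x)) := by
  refine ⟨hF.memLp.star, fun x hx => ?_⟩
  rw [hF.eq x hx, map_add, intervalIntegral.integral_of_le hx.1,
    intervalIntegral.integral_of_le hx.1, integral_conj]

end IsPrim

lemma absolutelyContinuousOnInterval_congr {f g : ℝ → ℂ} {a b : ℝ}
    (hf : AbsolutelyContinuousOnInterval f a b) (h : EqOn f g (uIcc a b)) :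
    AbsolutelyContinuousOnInterval g a b := by
  rw [absolutelyContinuousOnInterval_iff] at hf ⊢
  intro ε hε
  obtain ⟨δ, hδ, H⟩ := hf ε hε
  refine ⟨δ, hδ, fun E hE hE' => ?_⟩
  convert H E hE hE' using 1
  refine Finset.sum_congr rfl fun i hi => ?_
  rw [h (hE.1 i hi).1, h (hE.1 i hi).2]

lemma absolutelyContinuousOnInterval_integral (hℓ : 0 < ℓ) (c : ℂ) {f : ℝ → ℂ}
    (hf : MemLp f 2 (volume.restrict (Ioo 0 ℓ))) :
    AbsolutelyContinuousOnInterval (fun x => c + ∫ t in 0..x, f t) 0 ℓ := by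
  have hi := intervalIntegrable_of_memLp hf (left_mem_Icc.2 hℓ.le) (right_mem_Icc.2 hℓ.le)
  have hc (a : ℂ) : AbsolutelyContinuousOnInterval (fun _ : ℝ => a) 0 ℓ :=
    (LipschitzWith.const a).lipschitzOnWith.absolutelyContinuousOnInterval
  have hre : IntervalIntegrable (fun t => (f t).re) volume 0 ℓ := ⟨hi.1.re, hi.2.re⟩
  have him : IntervalIntegrable (fun t => (f t).im) volume 0 ℓ := ⟨hi.1.im, hi.2.im⟩
  have h1 := (hre.absolutelyContinuousOnInterval_intervalIntegral left_mem_uIcc).fun_smul (hc 1)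
  have h2 := (him.absolutelyContinuousOnInterval_intervalIntegral left_mem_uIcc).fun_smul
    (hc Complex.I)
  refine absolutelyContinuousOnInterval_congr ((hc c).add (h1.add h2)) fun x hx => ?_
  rw [uIcc_of_le hℓ.le] at hx
  have hx' := intervalIntegrable_of_memLp hf (left_mem_Icc.2 hℓ.le) hx
  have e1 := Complex.reCLM.intervalIntegral_comp_comm hx'
  have e2 := Complex.imCLM.intervalIntegral_comp_comm hx'
  simp only [Complex.reCLM_apply, Complex.imCLM_apply] at e1 e2
  simp only [Pi.add_apply, e1, e2, Complex.real_smul, mul_one, Complex.re_add_im]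

lemma ae_hasDerivAt_integral (hℓ : 0 < ℓ) (c : ℂ) {f : ℝ → ℂ}
    (hf : MemLp f 2 (volume.restrict (Ioo 0 ℓ))) :
    ∀ᵐ x, x ∈ uIcc 0 ℓ → HasDerivAt (fun x => c + ∫ t in 0..x, f t) (f x) x := by
  have hi := intervalIntegrable_of_memLp hf (left_mem_Icc.2 hℓ.le) (right_mem_Icc.2 hℓ.le)
  filter_upwards [hi.ae_hasDerivAt_integral] with x hx hx'
  exact (hx hx' 0 left_mem_uIcc).const_add c

namespace IsPrim

variable {F G f g : ℝ → ℂ}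

lemma mul (hℓ : 0 < ℓ) (hF : IsPrim ℓ F f) (hG : IsPrim ℓ G g) :
    IsPrim ℓ (fun x => F x * G x) (fun x => f x * G x + F x * g x) := by
  have hm : MemLp (fun x => f x * G x + F x * g x) 2 (volume.restrict (Ioo 0 ℓ)) :=
    (memLp_mul_continuousOn hF.memLp (hG.continuousOn hℓ)).add
      (memLp_continuousOn_mul (hF.continuousOn hℓ) hG.memLp)
  refine ⟨hm, fun x hx => ?_⟩
  have hac := ((absolutelyContinuousOnInterval_integral hℓ (F 0) hF.memLp).fun_smul
    (absolutelyContinuousOnInterval_integral hℓ (G 0) hG.memLp)).fun_sub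
    (absolutelyContinuousOnInterval_integral hℓ 0 hm)
  obtain ⟨C, hC⟩ := hac.const_of_ae_hasDerivAt_zero (by
    filter_upwards [ae_hasDerivAt_integral hℓ (F 0) hF.memLp,
      ae_hasDerivAt_integral hℓ (G 0) hG.memLp, ae_hasDerivAt_integral hℓ 0 hm] with y h1 h2 h3 hy
    have := ((h1 hy).fun_mul (h2 hy)).fun_sub (h3 hy)
    rw [uIcc_of_le hℓ.le] at hy
    rw [← hF.eq y hy, ← hG.eq y hy] at this
    simpa using this)
  have e0 := hC 0 left_mem_uIcc
  have ex := hC x (by rwa [uIcc_of_le hℓ.le])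
  rw [← e0, ← hF.eq x hx, ← hG.eq x hx] at ex
  simp only [smul_eq_mul, zero_add, intervalIntegral.integral_same, add_zero, sub_zero] at ex
  exact sub_eq_iff_eq_add.1 ex

lemma integral_parts (hℓ : 0 < ℓ) (hF : IsPrim ℓ F f) (hG : IsPrim ℓ G g) :
    (∫ x in (0 : ℝ)..ℓ, f x * G x) + ∫ x in (0 : ℝ)..ℓ, F x * g x = F ℓ * G ℓ - F 0 * G 0 := by
  have h0 : (0 : ℝ) ∈ Icc 0 ℓ := left_mem_Icc.2 hℓ.le
  have h1 : ℓ ∈ Icc 0 ℓ := right_mem_Icc.2 hℓ.le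
  rw [← intervalIntegral.integral_add
    (intervalIntegrable_of_memLp (memLp_mul_continuousOn hF.memLp (hG.continuousOn hℓ)) h0 h1)
    (intervalIntegrable_of_memLp (memLp_continuousOn_mul (hF.continuousOn hℓ) hG.memLp) h0 h1)]
  exact ((hF.mul hℓ hG).sub_eq h0 h1).symm

lemma of_hasDerivWithinAt (hf : ContinuousOn f (Icc 0 ℓ))
    (h : ∀ x ∈ Icc 0 ℓ, HasDerivWithinAt F (f x) (Icc 0 ℓ) x) : IsPrim ℓ F f := by
  refine ⟨memLp_of_continuousOn hf, fun x hx => ?_⟩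
  have hs : Icc 0 x ⊆ Icc 0 ℓ := Icc_subset_Icc_right hx.2
  rw [intervalIntegral.integral_eq_sub_of_hasDerivAt_of_le hx.1
    (fun y hy => (h y (hs hy)).continuousWithinAt.mono hs)
    (fun y hy => (h y (hs (Ioo_subset_Icc_self hy))).hasDerivAt
      (Icc_mem_nhds hy.1 (hy.2.trans_le hx.2)))
    (intervalIntegrable_of_memLp (memLp_of_continuousOn hf)
      (left_mem_Icc.2 (hx.1.trans hx.2)) hx)]
  ring

lemma hasDerivWithinAt (hℓ : 0 < ℓ) (h : IsPrim ℓ F f) (hf : ContinuousOn f (Icc 0 ℓ)) :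
    ∀ x ∈ Icc 0 ℓ, HasDerivWithinAt F (f x) (Icc 0 ℓ) x := by
  intro x hx
  have hc : Continuous (IccExtend hℓ.le (domRestrict (Icc 0 ℓ) f)) :=
    (continuousOn_iff_continuous_domRestrict.1 hf).Icc_extend'
  have hd := (intervalIntegral.integral_hasDerivAt_right (hc.intervalIntegrable 0 x)
    hc.aestronglyMeasurable.stronglyMeasurableAtFilter hc.continuousAt).const_add (F 0)
  have e (y : ℝ) (hy : y ∈ Icc 0 ℓ) : IccExtend hℓ.le (domRestrict (Icc 0 ℓ) f) y = f y := by
    rw [IccExtend_of_mem _ _ hy]; rfl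
  rw [e x hx] at hd
  refine hd.hasDerivWithinAt.congr_of_mem (fun y hy => ?_) hx
  rw [h.eq y hy]
  congr 1
  refine intervalIntegral.integral_congr fun t ht => ?_
  rw [uIcc_of_le hy.1] at ht
  exact (e t ⟨ht.1, ht.2.trans hy.2⟩).symm

lemma hasWeakDeriv (hℓ : 0 < ℓ) (h : IsPrim ℓ F f) : HasWeakDeriv ℓ F f := by
  refine ⟨memLp_of_continuousOn (h.continuousOn hℓ), h.memLp, fun φ hφ hc hs => ?_⟩
  have hd : Continuous (deriv φ) := hφ.continuous_deriv (by simp)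
  have hφ' : IsPrim ℓ (fun x => (φ x : ℂ)) (fun x => ((deriv φ x : ℝ) : ℂ)) :=
    of_hasDerivWithinAt (Complex.continuous_ofReal.comp hd).continuousOn fun x _ =>
      ((hφ.differentiable (by simp) x).hasDerivAt.ofReal_comp).hasDerivWithinAt
  have e0 : φ 0 = 0 := image_eq_zero_of_notMem_tsupport fun h => lt_irrefl _ (hs h).1
  have e1 : φ ℓ = 0 := image_eq_zero_of_notMem_tsupport fun h => lt_irrefl _ (hs h).2
  have := hφ'.integral_parts hℓ h
  simp only [e0, e1, Complex.ofReal_zero, zero_mul, sub_zero] at this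
  simp only [Complex.real_smul]
  rw [integral_Ioo_eq hℓ, integral_Ioo_eq hℓ]
  exact eq_neg_of_add_eq_zero_left this

end IsPrim

/-- A square integrable function that is orthogonal to all test functions vanishes. -/
lemma ae_eq_zero_of_integral_test_eq_zero {f : ℝ → ℂ}
    (hf : MemLp f 2 (volume.restrict (Ioo 0 ℓ)))
    (h : ∀ φ : ℝ → ℝ, ContDiff ℝ (⊤ : ℕ∞) φ → HasCompactSupport φ → tsupport φ ⊆ Ioo 0 ℓ →
      ∫ x in Ioo 0 ℓ, φ x • f x = 0) : f =ᵐ[volume.restrict (Ioo 0 ℓ)] 0 := by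
  have hi : IntegrableOn f (Ioo 0 ℓ) := hf.integrable (by norm_num)
  rw [Filter.EventuallyEq, ae_restrict_iff' measurableSet_Ioo]
  refine isOpen_Ioo.ae_eq_zero_of_integral_contDiff_smul_eq_zero hi.locallyIntegrableOn
    fun φ hφ hc hs => ?_
  rw [← h φ hφ hc hs, setIntegral_eq_integral_of_forall_compl_eq_zero]
  intro x hx
  rw [image_eq_zero_of_notMem_tsupport fun hx' => hx (hs hx'), zero_smul]

/-- Smooth primitive of a test function of mean zero. -/
lemma exists_test_primitive {ζ : ℝ → ℝ} (hζ : ContDiff ℝ (⊤ : ℕ∞) ζ) (hc : HasCompactSupport ζ)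
    (hs : tsupport ζ ⊆ Ioo 0 ℓ) (hi : ∫ x in (0 : ℝ)..ℓ, ζ x = 0) :
    ∃ φ : ℝ → ℝ, ContDiff ℝ (⊤ : ℕ∞) φ ∧ HasCompactSupport φ ∧ tsupport φ ⊆ Ioo 0 ℓ ∧
      deriv φ = ζ := by
  have hd (x : ℝ) : HasDerivAt (fun x => ∫ t in (0 : ℝ)..x, ζ t) (ζ x) x :=
    intervalIntegral.integral_hasDerivAt_right (hζ.continuous.intervalIntegrable 0 x)
      hζ.continuous.aestronglyMeasurable.stronglyMeasurableAtFilter hζ.continuous.continuousAt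
  have hder : deriv (fun x => ∫ t in (0 : ℝ)..x, ζ t) = ζ := funext fun x => (hd x).deriv
  have hz (x : ℝ) (hx : x ∉ tsupport ζ) : ζ x = 0 := image_eq_zero_of_notMem_tsupport hx
  obtain ⟨a, b, ha, hb, hab⟩ : ∃ a b, 0 < a ∧ b < ℓ ∧ tsupport ζ ⊆ Icc a b := by
    rcases (tsupport ζ).eq_empty_or_nonempty with he | hne
    · exact ⟨1, ℓ - 1, one_pos, by linarith, by simp [he]⟩
    · obtain ⟨a, ha⟩ := IsCompact.exists_isLeast hc hne
      obtain ⟨b, hb⟩ := IsCompact.exists_isGreatest hc hne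
      exact ⟨a, b, (hs ha.1).1, (hs hb.1).2, fun x hx => ⟨ha.2 hx, hb.2 hx⟩⟩
  have hsupp : tsupport (fun x => ∫ t in (0 : ℝ)..x, ζ t) ⊆ Icc a b := by
    refine closure_minimal (fun x hx => ?_) isClosed_Icc
    by_contra hx'
    apply hx
    rcases not_and_or.1 hx' with h | h
    · refine (intervalIntegral.integral_congr (g := fun _ => 0) fun t ht => hz t fun h' => ?_).trans
        intervalIntegral.integral_zero
      have := (hab h').1
      rcases le_total 0 x with h0 | h0
      · rw [uIcc_of_le h0] at ht; linarith [ht.2]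
      · rw [uIcc_of_ge h0] at ht; linarith [ht.2]
    · have e := intervalIntegral.integral_add_adjacent_intervals
        (hζ.continuous.intervalIntegrable (μ := volume) 0 x)
        (hζ.continuous.intervalIntegrable (μ := volume) x ℓ)
      have e' : ∫ t in x..ℓ, ζ t = ∫ t in x..ℓ, 0 := by
        refine intervalIntegral.integral_congr fun t ht => hz t fun h' => ?_
        have := (hab h').2
        rcases le_total x ℓ with h0 | h0
        · rw [uIcc_of_le h0] at ht; linarith [ht.1]
        · rw [uIcc_of_ge h0] at ht; linarith [ht.1]
      rw [hi, e', intervalIntegral.integral_zero, add_zero] at e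
      exact e
  refine ⟨_, ?_, HasCompactSupport.of_support_subset_isCompact isCompact_Icc
    (subset_tsupport _ |>.trans hsupp), hsupp.trans fun x hx => ⟨ha.trans_le hx.1,
    hx.2.trans_lt hb⟩, hder⟩
  refine contDiff_infty_iff_deriv.2 ⟨fun x => (hd x).differentiableAt, ?_⟩
  rw [hder]
  exact hζ

/-- A function with vanishing weak derivative is constant. -/
lemma HasWeakDeriv.ae_eq_const (hℓ : 0 < ℓ) {f : ℝ → ℂ} (h : HasWeakDeriv ℓ f 0) :
    ∃ c : ℂ, f =ᵐ[volume.restrict (Ioo 0 ℓ)] fun _ => c := by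
  let B : ContDiffBump (ℓ / 2) := ⟨ℓ / 8, ℓ / 4, by linarith, by linarith⟩
  set ψ : ℝ → ℝ := B.normed volume with hψ
  have hψd : ContDiff ℝ (⊤ : ℕ∞) ψ := B.contDiff_normed
  have hψc : HasCompactSupport ψ := B.hasCompactSupport_normed
  have hψs : tsupport ψ ⊆ Ioo 0 ℓ := by
    rw [hψ, B.tsupport_normed_eq, Real.closedBall_eq_Icc]
    intro x hx
    simp only [B, mem_Icc] at hx
    constructor <;> linarith [hx.1, hx.2]
  have hint (η : ℝ → ℝ) (hs : tsupport η ⊆ Ioo 0 ℓ) : ∫ x in (0 : ℝ)..ℓ, η x = ∫ x, η x := by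
    rw [intervalIntegral.integral_of_le hℓ.le, integral_Ioc_eq_integral_Ioo]
    refine setIntegral_eq_integral_of_forall_compl_eq_zero fun x hx => ?_
    exact image_eq_zero_of_notMem_tsupport fun hx' => hx (hs hx')
  refine ⟨∫ x in Ioo 0 ℓ, ψ x • f x, ?_⟩
  set c := ∫ x in Ioo 0 ℓ, ψ x • f x with hcdef
  have hcm : MemLp (fun _ : ℝ => c) 2 (volume.restrict (Ioo 0 ℓ)) :=
    memLp_of_continuousOn continuousOn_const
  have key : f - (fun _ => c) =ᵐ[volume.restrict (Ioo 0 ℓ)] 0 := by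
    refine ae_eq_zero_of_integral_test_eq_zero (h.memLp_fun.sub hcm) fun η hη hc hs => ?_
    set m := ∫ x in (0 : ℝ)..ℓ, η x with hm
    have hi1 := integrable_smul_of_memLp hη.continuous hc h.memLp_fun
    have hi2 := integrable_smul_of_memLp hη.continuous hc hcm
    have hi3 := integrable_smul_of_memLp hψd.continuous hψc h.memLp_fun
    have hmψ : HasCompactSupport fun x => m * ψ x := hψc.mul_left
    have hmψs : tsupport (fun x => m * ψ x) ⊆ Ioo 0 ℓ := (tsupport_mul_subset_right).trans hψs
    obtain ⟨φ, h1, h2, h3, h4⟩ := exists_test_primitive (ζ := fun x => η x - m * ψ x) (ℓ := ℓ)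
      (hη.sub (contDiff_const.mul hψd)) (hc.sub hmψ)
      ((tsupport_sub _ _).trans (union_subset hs hmψs)) (by
        rw [intervalIntegral.integral_sub (hη.continuous.intervalIntegrable _ _)
          ((hψd.continuous.const_mul m).intervalIntegrable _ _),
          intervalIntegral.integral_const_mul, hint ψ hψs, B.integral_normed, mul_one, sub_self])
    have e := h.integral_eq φ h1 h2 h3
    simp only [h4, Pi.zero_apply, smul_zero, integral_zero, neg_zero, sub_smul, mul_smul] at e
    rw [integral_sub hi1 (hi3.fun_smul m), integral_smul, ← hcdef] at e
    simp only [Pi.sub_apply, smul_sub]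
    rw [integral_sub hi1 hi2, integral_smul_const, ← e]
    congr 2
    rw [hm, intervalIntegral.integral_of_le hℓ.le, integral_Ioc_eq_integral_Ioo]
  filter_upwards [key] with x hx
  simpa [sub_eq_zero] using hx

lemma HasWeakDeriv.exists_isPrim (hℓ : 0 < ℓ) {f g : ℝ → ℂ} (h : HasWeakDeriv ℓ f g) :
    ∃ F, IsPrim ℓ F g ∧ f =ᵐ[volume.restrict (Ioo 0 ℓ)] F := by
  have h1 := (isPrim_integral 0 h.memLp_deriv).hasWeakDeriv hℓ
  have h2 := h.add (h1.const_smul (-1))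
  obtain ⟨c, hc⟩ := HasWeakDeriv.ae_eq_const hℓ (by
    convert h2 using 1
    ext x
    simp)
  refine ⟨fun x => c + ∫ t in 0..x, g t, isPrim_integral c h.memLp_deriv, ?_⟩
  filter_upwards [hc] with x hx
  simp at hx ⊢
  rw [← hx]
  ring

lemma IsPrim.ae_eq_zero (hℓ : 0 < ℓ) {F f : ℝ → ℂ} (h : IsPrim ℓ F f)
    (hF : ∀ x ∈ Icc 0 ℓ, F x = 0) : f =ᵐ[volume.restrict (Ioo 0 ℓ)] 0 := by
  refine ae_eq_zero_of_integral_test_eq_zero h.memLp fun φ hφ hc hs => ?_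
  rw [← neg_eq_zero, ← (h.hasWeakDeriv hℓ).integral_eq φ hφ hc hs]
  refine (setIntegral_congr_fun measurableSet_Ioo fun x hx => ?_).trans (integral_zero _ _)
  simp [hF x (Ioo_subset_Icc_self hx)]

lemma HasWeakDeriv.congr_ae {f g f' : ℝ → ℂ} (h : HasWeakDeriv ℓ f g)
    (hf : f' =ᵐ[volume.restrict (Ioo 0 ℓ)] f) : HasWeakDeriv ℓ f' g := by
  refine ⟨h.1.ae_eq hf.symm, h.2, fun φ hφ hc hs => ?_⟩
  rw [← h.3 φ hφ hc hs]
  refine integral_congr_ae ?_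
  filter_upwards [hf] with x hx
  rw [hx]

lemma HasWeakDeriv.ofReal {f g : ℝ → ℝ} (h : HasWeakDeriv ℓ f g) :
    HasWeakDeriv ℓ (fun x => (f x : ℂ)) (fun x => (g x : ℂ)) := by
  refine ⟨h.1.ofReal, h.2.ofReal, fun φ hφ hc hs => ?_⟩
  have := congrArg (Complex.ofReal) (h.3 φ hφ hc hs)
  rw [Complex.ofReal_neg, ← integral_complex_ofReal, ← integral_complex_ofReal] at this
  simpa using this

lemma HasWeakDeriv.exists_isPrim_real (hℓ : 0 < ℓ) {f g : ℝ → ℝ} (h : HasWeakDeriv ℓ f g) :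
    ∃ F : ℝ → ℝ, IsPrim ℓ (fun x => (F x : ℂ)) (fun x => (g x : ℂ)) ∧
      f =ᵐ[volume.restrict (Ioo 0 ℓ)] F := by
  obtain ⟨F, hF, hfF⟩ := h.ofReal.exists_isPrim hℓ
  refine ⟨fun x => (F x).re, ⟨hF.memLp, fun x hx => ?_⟩, ?_⟩
  · beta_reduce
    rw [hF.eq x hx, intervalIntegral.integral_ofReal]
    simp
  · filter_upwards [hfF] with x hx
    rw [← hx, Complex.ofReal_re]

lemma le_of_ae_le_continuousOn (hℓ : 0 < ℓ) {a A : ℝ → ℝ} {c : ℝ}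
    (hA : ContinuousOn A (Icc 0 ℓ)) (h : a =ᵐ[volume.restrict (Ioo 0 ℓ)] A)
    (ha : ∀ x ∈ Icc 0 ℓ, c ≤ a x) : ∀ x ∈ Icc 0 ℓ, c ≤ A x := by
  have hm : ContinuousOn (fun x => max (A x) c) (Icc 0 ℓ) := hA.sup continuousOn_const
  have := eqOn_Icc_of_ae_eq (f := fun x => ((max (A x) c : ℝ) : ℂ))
    (g := fun x => (A x : ℂ)) (Complex.continuous_ofReal.comp_continuousOn hm)
    (Complex.continuous_ofReal.comp_continuousOn hA) hℓ (by
      filter_upwards [h, ae_restrict_mem measurableSet_Ioo] with x hx hx'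
      rw [max_eq_left]
      rw [← hx]
      exact ha x (Ioo_subset_Icc_self hx'))
  intro x hx
  have h2 := this hx
  simp only [Complex.ofReal_inj] at h2
  exact max_eq_left_iff.1 h2

/-- Coefficients of the clamped beam problem: the continuous representatives of `σ`, `q`, `ρ`. -/
structure Beam (ℓ : ℝ) (s k p : ℝ → ℝ) : Prop where
  pos : 0 < ℓ
  prim_s : ∃ s' s'' : ℝ → ℂ, IsPrim ℓ (fun x => (s x : ℂ)) s' ∧ IsPrim ℓ s' s''
  prim_k : ∃ k' : ℝ → ℂ, IsPrim ℓ (fun x => (k x : ℂ)) k'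
  cont_p : ContinuousOn p (Icc 0 ℓ)
  s_pos : ∀ x ∈ Icc 0 ℓ, 0 < s x
  k_nonneg : ∀ x ∈ Icc 0 ℓ, 0 ≤ k x
  p_pos : ∀ x ∈ Icc 0 ℓ, 0 < p x

lemma IsPrim.continuousOn_real (hℓ : 0 < ℓ) {a : ℝ → ℝ} {a' : ℝ → ℂ}
    (h : IsPrim ℓ (fun x => (a x : ℂ)) a') : ContinuousOn a (Icc 0 ℓ) :=
  (Complex.continuous_re.comp_continuousOn (h.continuousOn hℓ)).congr fun _ _ => rfl

lemma Beam.cont_s {s k p : ℝ → ℝ} (B : Beam ℓ s k p) : ContinuousOn s (Icc 0 ℓ) := by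
  obtain ⟨s', s'', h, -⟩ := B.prim_s
  exact h.continuousOn_real B.pos

lemma Beam.cont_k {s k p : ℝ → ℝ} (B : Beam ℓ s k p) : ContinuousOn k (Icc 0 ℓ) := by
  obtain ⟨k', h⟩ := B.prim_k
  exact h.continuousOn_real B.pos

lemma exists_beam (hℓ : 0 < ℓ) {σ q ρ : ℝ → ℝ} (hρH : MemH ℓ 2 ρ) (hσH : MemH ℓ 2 σ)
    (hqH : MemH ℓ 1 q) {ρ₀ σ₀ : ℝ} (hρ₀ : 0 < ρ₀) (hσ₀ : 0 < σ₀)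
    (hρ : ∀ x ∈ Icc 0 ℓ, ρ₀ ≤ ρ x) (hσ : ∀ x ∈ Icc 0 ℓ, σ₀ ≤ σ x) (hq : ∀ x ∈ Icc 0 ℓ, 0 ≤ q x) :
    ∃ s k p : ℝ → ℝ, Beam ℓ s k p ∧ σ =ᵐ[volume.restrict (Ioo 0 ℓ)] s ∧
      q =ᵐ[volume.restrict (Ioo 0 ℓ)] k ∧ ρ =ᵐ[volume.restrict (Ioo 0 ℓ)] p := by
  obtain ⟨σ', hσ', σ'', hσ'', -⟩ := hσH
  obtain ⟨ρ', hρ', -⟩ := hρH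
  obtain ⟨q', hq', -⟩ := hqH
  obtain ⟨s, hs, es⟩ := hσ'.exists_isPrim_real hℓ
  obtain ⟨s', hs', es'⟩ := hσ''.exists_isPrim_real hℓ
  obtain ⟨p, hp, ep⟩ := hρ'.exists_isPrim_real hℓ
  obtain ⟨k, hk, ek⟩ := hq'.exists_isPrim_real hℓ
  refine ⟨s, k, p, ⟨hℓ, ⟨_, _, hs.congr_right ?_, hs'⟩, ⟨_, hk⟩, hp.continuousOn_real hℓ,
    fun x hx => hσ₀.trans_le ?_, ?_, fun x hx => hρ₀.trans_le ?_⟩, es, ek, ep⟩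
  · filter_upwards [es'] with x hx
    rw [hx]
  · exact le_of_ae_le_continuousOn hℓ (hs.continuousOn_real hℓ) es hσ x hx
  · exact le_of_ae_le_continuousOn hℓ (hk.continuousOn_real hℓ) ek hq
  · exact le_of_ae_le_continuousOn hℓ (hp.continuousOn_real hℓ) ep hρ x hx

/-- The equation `(s u'')'' - (k u')' = g` with clamped ends as a first order system for `u`,
`u₁ = u'`, `m = s u''` and `t = m' - k u'`. -/
structure ClampedSol (ℓ : ℝ) (s k : ℝ → ℝ) (g u u₁ m t : ℝ → ℂ) : Prop where
  prim_u : IsPrim ℓ u u₁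
  prim_u₁ : IsPrim ℓ u₁ (fun x => m x / s x)
  prim_m : IsPrim ℓ m (fun x => t x + k x * u₁ x)
  prim_t : IsPrim ℓ t g
  left : u 0 = 0
  left_deriv : u₁ 0 = 0
  right : u ℓ = 0
  right_deriv : u₁ ℓ = 0

lemma SolvesClamped.exists_clampedSol {s k p : ℝ → ℝ} (B : Beam ℓ s k p) {σ q : ℝ → ℝ}
    (es : σ =ᵐ[volume.restrict (Ioo 0 ℓ)] s) (ek : q =ᵐ[volume.restrict (Ioo 0 ℓ)] k)
    {u g : ℝ → ℂ} (h : SolvesClamped ℓ σ q u g) :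
    ∃ u₁ m t, ClampedSol ℓ s k g u u₁ m t ∧ iteratedDerivWithin 2 u (Icc 0 ℓ) ℓ = m ℓ / s ℓ := by
  have hℓ := B.pos
  obtain ⟨hd, m₁, m₂, p₁, h1, h2, h3, he⟩ := h
  have hU := uniqueDiffOn_Icc hℓ
  set u₁ := derivWithin u (Icc 0 ℓ) with hu₁
  set u₂ := iteratedDerivWithin 2 u (Icc 0 ℓ) with hu₂
  have eu₂ : u₂ = derivWithin u₁ (Icc 0 ℓ) := by
    rw [hu₂, iteratedDerivWithin_succ, iteratedDerivWithin_one]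
  have hc1 : ContDiffOn ℝ 2 u₁ (Icc 0 ℓ) := hd.contDiffOn.derivWithin hU (by norm_num)
  have hc2 : ContDiffOn ℝ 1 u₂ (Icc 0 ℓ) := eu₂ ▸ hc1.derivWithin hU (by norm_num)
  have d0 : IsPrim ℓ u u₁ := IsPrim.of_hasDerivWithinAt hc1.continuousOn fun x hx =>
    (hd.differentiableWithinAt hx).hasDerivWithinAt
  have d1 : IsPrim ℓ u₁ u₂ := IsPrim.of_hasDerivWithinAt hc2.continuousOn fun x hx => by
    rw [eu₂]
    exact (hc1.differentiableOn (by norm_num) x hx).hasDerivWithinAt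
  have cs : ContinuousOn (fun x => (s x : ℂ)) (Icc 0 ℓ) :=
    Complex.continuous_ofReal.comp_continuousOn B.cont_s
  have ck : ContinuousOn (fun x => (k x : ℂ)) (Icc 0 ℓ) :=
    Complex.continuous_ofReal.comp_continuousOn B.cont_k
  obtain ⟨F, hF, eF⟩ := h1.exists_isPrim hℓ
  obtain ⟨F₁, hF₁, eF₁⟩ := h2.exists_isPrim hℓ
  obtain ⟨F₂, hF₂, eF₂⟩ := h3.exists_isPrim hℓ
  have e1 : EqOn (fun x => s x * u₂ x) F (Icc 0 ℓ) := by
    refine eqOn_Icc_of_ae_eq (cs.mul hc2.continuousOn) (hF.continuousOn hℓ) hℓ ?_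
    filter_upwards [eF, es] with x hx hx'
    rw [← hx, hx', Complex.real_smul]
  have e2 : EqOn (fun x => k x * u₁ x) F₂ (Icc 0 ℓ) := by
    refine eqOn_Icc_of_ae_eq (ck.mul hc1.continuousOn) (hF₂.continuousOn hℓ) hℓ ?_
    filter_upwards [eF₂, ek] with x hx hx'
    rw [← hx, hx', Complex.real_smul]
  have e3 : ∀ x ∈ Icc 0 ℓ, u₂ x = s x * u₂ x / s x := fun x hx => by
    rw [mul_div_cancel_left₀ _ (Complex.ofReal_ne_zero.2 (B.s_pos x hx).ne')]
  refine ⟨u₁, fun x => s x * u₂ x, fun x => F₁ x - k x * u₁ x, ⟨d0, d1.congr_right_on e3,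
    (hF.congr_left e1).congr_right ?_, ?_, hd.left, hd.deriv_left, hd.right, hd.deriv_right⟩,
    e3 ℓ (right_mem_Icc.2 hℓ.le)⟩
  · filter_upwards [eF₁] with x hx
    rw [hx]
    ring
  · exact (hF₁.sub (hF₂.congr_left e2)).congr_right he

lemma contDiffOn_of_hasDerivWithinAt (hℓ : 0 < ℓ) {n : ℕ} {F f : ℝ → ℂ}
    (h : ∀ x ∈ Icc 0 ℓ, HasDerivWithinAt F (f x) (Icc 0 ℓ) x) (hf : ContDiffOn ℝ n f (Icc 0 ℓ)) :
    ContDiffOn ℝ (n + 1) F (Icc 0 ℓ) := by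
  have hU := uniqueDiffOn_Icc hℓ
  rw [contDiffOn_succ_iff_derivWithin hU]
  refine ⟨fun x hx => (h x hx).differentiableWithinAt, by simp, hf.congr fun x hx => ?_⟩
  exact (h x hx).derivWithin (hU x hx)

lemma ClampedSol.solvesClamped {s k p : ℝ → ℝ} (B : Beam ℓ s k p) {σ q : ℝ → ℝ}
    (es : σ =ᵐ[volume.restrict (Ioo 0 ℓ)] s) (ek : q =ᵐ[volume.restrict (Ioo 0 ℓ)] k)
    {u u₁ m t g : ℝ → ℂ} (h : ClampedSol ℓ s k g u u₁ m t) :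
    SolvesClamped ℓ σ q u g := by
  have hℓ := B.pos
  have hU := uniqueDiffOn_Icc hℓ
  have h0 : (0 : ℝ) ∈ Icc 0 ℓ := left_mem_Icc.2 hℓ.le
  have hl : ℓ ∈ Icc 0 ℓ := right_mem_Icc.2 hℓ.le
  obtain ⟨s', s'', hs', hs''⟩ := B.prim_s
  obtain ⟨k', hk'⟩ := B.prim_k
  have hr : IsPrim ℓ (fun x => (s x : ℂ)⁻¹) (fun x => - s' x / (s x : ℂ) ^ 2) := by
    refine IsPrim.of_hasDerivWithinAt ?_ fun x hx => ?_
    · exact (hs''.continuousOn hℓ).neg.div ((hs'.continuousOn hℓ).pow 2) fun x hx =>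
        pow_ne_zero 2 (Complex.ofReal_ne_zero.2 (B.s_pos x hx).ne')
    · exact (hs'.hasDerivWithinAt hℓ (hs''.continuousOn hℓ) x hx).fun_inv
        (Complex.ofReal_ne_zero.2 (B.s_pos x hx).ne')
  have hr' := (hs''.neg).mul hℓ (hr.mul hℓ hr)
  have hku := hk'.mul hℓ h.prim_u₁
  have htk := h.prim_t.add hku
  have hw := h.prim_m.mul hℓ hr
  have hw' := (htk.mul hℓ hr).add (h.prim_m.mul hℓ hr')
  have hw1 : IsPrim ℓ (fun x => m x / s x) (fun x => (t x + k x * u₁ x) * (s x : ℂ)⁻¹ +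
      m x * (- s' x * ((s x : ℂ)⁻¹ * (s x : ℂ)⁻¹))) := by
    refine (hw.congr_left fun x _ => div_eq_mul_inv _ _).congr_right_on fun x _ => ?_
    simp only [div_eq_mul_inv, ← inv_pow]
    ring
  have c0 := h.prim_u.hasDerivWithinAt hℓ (h.prim_u₁.continuousOn hℓ)
  have c1 := h.prim_u₁.hasDerivWithinAt hℓ (hw1.continuousOn hℓ)
  have c2 := hw1.hasDerivWithinAt hℓ (hw'.continuousOn hℓ)
  have du : EqOn (derivWithin u (Icc 0 ℓ)) u₁ (Icc 0 ℓ) := fun x hx =>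
    (c0 x hx).derivWithin (hU x hx)
  have du₂ : EqOn (iteratedDerivWithin 2 u (Icc 0 ℓ)) (fun x => m x / s x) (Icc 0 ℓ) := by
    intro x hx
    rw [iteratedDerivWithin_succ, iteratedDerivWithin_one, derivWithin_congr du (du hx)]
    exact (c1 x hx).derivWithin (hU x hx)
  refine ⟨⟨⟨_, h.prim_u.hasWeakDeriv hℓ, _, h.prim_u₁.hasWeakDeriv hℓ, _, hw1.hasWeakDeriv hℓ, _,
    hw'.hasWeakDeriv hℓ, hw'.memLp⟩, ?_, h.left, (du h0).trans h.left_deriv, h.right,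
    (du hl).trans h.right_deriv⟩, _, _, _, (h.prim_m.hasWeakDeriv hℓ).congr_ae ?_,
    htk.hasWeakDeriv hℓ, (hku.hasWeakDeriv hℓ).congr_ae ?_, ?_⟩
  · have a2 := contDiffOn_of_hasDerivWithinAt (n := 0) hℓ c2
      (contDiffOn_zero.2 (hw'.continuousOn hℓ))
    have a1 := contDiffOn_of_hasDerivWithinAt (n := 1) hℓ c1 (by simpa using a2)
    have a0 := contDiffOn_of_hasDerivWithinAt (n := 2) hℓ c0 (by simpa [one_add_one_eq_two] using a1)
    exact a0.of_le (by norm_num)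
  · filter_upwards [es, ae_restrict_mem measurableSet_Ioo] with x hx hx'
    have hx'' := Ioo_subset_Icc_self hx'
    rw [hx, du₂ hx'', Complex.real_smul,
      mul_div_cancel₀ _ (Complex.ofReal_ne_zero.2 (B.s_pos x hx'').ne')]
  · filter_upwards [ek, ae_restrict_mem measurableSet_Ioo] with x hx hx'
    rw [hx, du (Ioo_subset_Icc_self hx'), Complex.real_smul]
  · exact Filter.Eventually.of_forall fun x => by simp

variable {s k p : ℝ → ℝ}

namespace ClampedSol

variable {g h u u₁ m t v v₁ n r : ℝ → ℂ}

lemma congr_right (H : ClampedSol ℓ s k g u u₁ m t)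
    (e : g =ᵐ[volume.restrict (Ioo 0 ℓ)] h) : ClampedSol ℓ s k h u u₁ m t :=
  { H with prim_t := H.prim_t.congr_right e }

lemma conj (H : ClampedSol ℓ s k g u u₁ m t) :
    ClampedSol ℓ s k (fun x => (starRingEnd ℂ) (g x)) (fun x => (starRingEnd ℂ) (u x))
      (fun x => (starRingEnd ℂ) (u₁ x)) (fun x => (starRingEnd ℂ) (m x))
      (fun x => (starRingEnd ℂ) (t x)) where
  prim_u := H.prim_u.conj
  prim_u₁ := by simpa using H.prim_u₁.conj
  prim_m := by simpa using H.prim_m.conj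
  prim_t := H.prim_t.conj
  left := by simp [H.left]
  left_deriv := by simp [H.left_deriv]
  right := by simp [H.right]
  right_deriv := by simp [H.right_deriv]

lemma sub (H : ClampedSol ℓ s k g u u₁ m t) (H' : ClampedSol ℓ s k h v v₁ n r) :
    ClampedSol ℓ s k (fun x => g x - h x) (fun x => u x - v x) (fun x => u₁ x - v₁ x)
      (fun x => m x - n x) (fun x => t x - r x) where
  prim_u := H.prim_u.sub H'.prim_u
  prim_u₁ := by simpa only [sub_div] using H.prim_u₁.sub H'.prim_u₁
  prim_m := (H.prim_m.sub H'.prim_m).congr_right_on fun x _ => by ring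
  prim_t := H.prim_t.sub H'.prim_t
  left := by simp [H.left, H'.left]
  left_deriv := by simp [H.left_deriv, H'.left_deriv]
  right := by simp [H.right, H'.right]
  right_deriv := by simp [H.right_deriv, H'.right_deriv]

lemma const_mul (H : ClampedSol ℓ s k g u u₁ m t) (c : ℂ) :
    ClampedSol ℓ s k (fun x => c * g x) (fun x => c * u x) (fun x => c * u₁ x)
      (fun x => c * m x) (fun x => c * t x) where
  prim_u := H.prim_u.const_mul c
  prim_u₁ := by simpa only [mul_div_assoc] using H.prim_u₁.const_mul c
  prim_m := (H.prim_m.const_mul c).congr_right_on fun x _ => by ring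
  prim_t := H.prim_t.const_mul c
  left := by simp [H.left]
  left_deriv := by simp [H.left_deriv]
  right := by simp [H.right]
  right_deriv := by simp [H.right_deriv]

/-- The weak form of the equation, tested with another clamped function. -/
lemma integral_mul_eq (B : Beam ℓ s k p) (H : ClampedSol ℓ s k g u u₁ m t)
    (H' : ClampedSol ℓ s k h v v₁ n r) :
    ∫ x in (0 : ℝ)..ℓ, g x * v x =
      ∫ x in (0 : ℝ)..ℓ, (k x * (u₁ x * v₁ x) + m x * n x / s x) := by
  have hℓ := B.pos
  have h0 : (0 : ℝ) ∈ Icc 0 ℓ := left_mem_Icc.2 hℓ.le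
  have hl : ℓ ∈ Icc 0 ℓ := right_mem_Icc.2 hℓ.le
  have e1 := H.prim_t.integral_parts hℓ H'.prim_u
  have e2 := H.prim_m.integral_parts hℓ H'.prim_u₁
  rw [H'.left, H'.right, mul_zero, mul_zero, sub_zero] at e1
  rw [H'.left_deriv, H'.right_deriv, mul_zero, mul_zero, sub_zero] at e2
  have ck : ContinuousOn (fun x => (k x : ℂ)) (Icc 0 ℓ) :=
    Complex.continuous_ofReal.comp_continuousOn B.cont_k
  have cv := H'.prim_u₁.continuousOn hℓ
  have i1 := intervalIntegrable_of_memLp (memLp_mul_continuousOn H.prim_m.memLp cv) h0 hl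
  have i2 := intervalIntegrable_of_memLp (memLp_continuousOn_mul (H.prim_m.continuousOn hℓ)
    H'.prim_u₁.memLp) h0 hl
  have i3 := intervalIntegrable_of_memLp (memLp_continuousOn_mul (H.prim_t.continuousOn hℓ)
    H'.prim_u.memLp) h0 hl
  rw [← intervalIntegral.integral_add i1 i2] at e2
  rw [eq_neg_of_add_eq_zero_left e1, ← sub_eq_zero, sub_eq_add_neg, ← neg_add, neg_eq_zero, ← e2,
    ← intervalIntegral.integral_add i3]
  · refine intervalIntegral.integral_congr fun x _ => ?_
    ring
  · have := (i1.add i2).sub i3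
    refine this.congr fun x _ => ?_
    ring

/-- Symmetry of the clamped beam operator. -/
lemma integral_mul_comm (B : Beam ℓ s k p) (H : ClampedSol ℓ s k g u u₁ m t)
    (H' : ClampedSol ℓ s k h v v₁ n r) :
    ∫ x in (0 : ℝ)..ℓ, g x * v x = ∫ x in (0 : ℝ)..ℓ, h x * u x := by
  rw [H.integral_mul_eq B H', H'.integral_mul_eq B H]
  refine intervalIntegral.integral_congr fun x _ => ?_
  ring

end ClampedSol

lemma eqOn_zero_of_integral_weight_eq_zero (hℓ : 0 < ℓ) {a : ℝ → ℝ} {f : ℝ → ℂ}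
    (ha : ContinuousOn a (Icc 0 ℓ)) (ha' : ∀ x ∈ Icc 0 ℓ, 0 < a x) (hf : ContinuousOn f (Icc 0 ℓ))
    (h : ∫ x in (0 : ℝ)..ℓ, a x * ‖f x‖ ^ 2 ≤ 0) : ∀ x ∈ Icc 0 ℓ, f x = 0 := by
  by_contra! hne
  obtain ⟨x, hx, hfx⟩ := hne
  refine h.not_gt (intervalIntegral.integral_pos hℓ (ha.mul (hf.norm.pow 2)) (fun y hy => ?_)
    ⟨x, hx, mul_pos (ha' x hx) (by positivity)⟩)
  exact mul_nonneg (ha' y (Ioc_subset_Icc_self hy)).le (by positivity)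

namespace ClampedSol

variable {g h u u₁ m t v v₁ n r : ℝ → ℂ}

lemma energy (B : Beam ℓ s k p) (H : ClampedSol ℓ s k g u u₁ m t) :
    ∫ x in (0 : ℝ)..ℓ, g x * (starRingEnd ℂ) (u x) =
      ((∫ x in (0 : ℝ)..ℓ, (k x * ‖u₁ x‖ ^ 2 + (s x)⁻¹ * ‖m x‖ ^ 2) : ℝ) : ℂ) := by
  rw [H.integral_mul_eq B H.conj, ← intervalIntegral.integral_ofReal]
  refine intervalIntegral.integral_congr fun x _ => ?_
  simp only [Complex.mul_conj, Complex.normSq_eq_norm_sq]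
  push_cast
  ring

lemma integral_energy_nonneg (B : Beam ℓ s k p) :
    0 ≤ ∫ x in (0 : ℝ)..ℓ, (k x * ‖u₁ x‖ ^ 2 + (s x)⁻¹ * ‖m x‖ ^ 2) := by
  refine intervalIntegral.integral_nonneg B.pos.le fun x hx => ?_
  have := B.k_nonneg x hx
  have := B.s_pos x hx
  positivity

lemma eq_zero_of_m (H : ClampedSol ℓ s k g u u₁ m t)
    (hm : ∀ x ∈ Icc 0 ℓ, m x = 0) : ∀ x ∈ Icc 0 ℓ, u x = 0 := by
  have h1 : ∀ x ∈ Icc 0 ℓ, u₁ x = 0 := fun x hx => by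
    rw [H.prim_u₁.eq x hx, H.left_deriv, zero_add]
    refine (intervalIntegral.integral_congr (g := fun _ => 0) fun y hy => ?_).trans
      intervalIntegral.integral_zero
    rw [uIcc_of_le hx.1] at hy
    simp [hm y ⟨hy.1, hy.2.trans hx.2⟩]
  intro x hx
  rw [H.prim_u.eq x hx, H.left, zero_add]
  refine (intervalIntegral.integral_congr (g := fun _ => 0) fun y hy => ?_).trans
    intervalIntegral.integral_zero
  rw [uIcc_of_le hx.1] at hy
  simp [h1 y ⟨hy.1, hy.2.trans hx.2⟩]

lemma eq_zero_of_energy (B : Beam ℓ s k p) (H : ClampedSol ℓ s k g u u₁ m t)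
    (hE : ∫ x in (0 : ℝ)..ℓ, (k x * ‖u₁ x‖ ^ 2 + (s x)⁻¹ * ‖m x‖ ^ 2) = 0) :
    ∀ x ∈ Icc 0 ℓ, u x = 0 := by
  have hℓ := B.pos
  have cm := H.prim_m.continuousOn hℓ
  have cs : ContinuousOn (fun x => (s x)⁻¹) (Icc 0 ℓ) :=
    B.cont_s.inv₀ fun x hx => (B.s_pos x hx).ne'
  have c1 : ContinuousOn (fun x => k x * ‖u₁ x‖ ^ 2) (Icc 0 ℓ) :=
    B.cont_k.mul ((H.prim_u₁.continuousOn hℓ).norm.pow 2)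
  have c2 : ContinuousOn (fun x => (s x)⁻¹ * ‖m x‖ ^ 2) (Icc 0 ℓ) := cs.mul (cm.norm.pow 2)
  refine H.eq_zero_of_m (eqOn_zero_of_integral_weight_eq_zero hℓ cs
    (fun x hx => inv_pos.2 (B.s_pos x hx)) cm (le_of_le_of_eq ?_ hE))
  refine intervalIntegral.integral_mono_on (μ := volume) hℓ.le (c2.intervalIntegrable_of_Icc hℓ.le)
    ((c1.add c2).intervalIntegrable_of_Icc hℓ.le) fun x hx => ?_
  have := B.k_nonneg x hx
  exact le_add_of_nonneg_left (by positivity)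

lemma eq_zero (B : Beam ℓ s k p) (H : ClampedSol ℓ s k g u u₁ m t)
    (hg : g =ᵐ[volume.restrict (Ioo 0 ℓ)] 0) : ∀ x ∈ Icc 0 ℓ, u x = 0 := by
  refine H.eq_zero_of_energy B (Complex.ofReal_injective ?_)
  rw [← H.energy B, ← integral_Ioo_eq B.pos, Complex.ofReal_zero]
  refine (integral_congr_ae (g := fun _ => 0) ?_).trans (integral_zero _ _)
  filter_upwards [hg] with x hx
  simp [hx]

lemma unique (B : Beam ℓ s k p) (H : ClampedSol ℓ s k g u u₁ m t)
    (H' : ClampedSol ℓ s k h v v₁ n r) (e : g =ᵐ[volume.restrict (Ioo 0 ℓ)] h) :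
    ∀ x ∈ Icc 0 ℓ, u x = v x := fun x hx =>
  sub_eq_zero.1 ((H.sub H').eq_zero B (by filter_upwards [e] with x hx; simp [hx]) x hx)

/-- Every eigenvalue is real and positive. -/
lemma eigenvalue_pos (B : Beam ℓ s k p) {z : ℂ}
    (H : ClampedSol ℓ s k (fun x => z * p x * u x) u u₁ m t) (hu : ∃ x ∈ Icc 0 ℓ, u x ≠ 0) :
    ∃ a : ℝ, 0 < a ∧ z = a := by
  have hℓ := B.pos
  set N := ∫ x in (0 : ℝ)..ℓ, p x * ‖u x‖ ^ 2 with hN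
  have hNpos : 0 < N := by
    by_contra hle
    obtain ⟨x, hx, hx'⟩ := hu
    exact hx' (eqOn_zero_of_integral_weight_eq_zero hℓ B.cont_p B.p_pos
      (H.prim_u.continuousOn hℓ) (not_lt.1 hle) x hx)
  set E := ∫ x in (0 : ℝ)..ℓ, (k x * ‖u₁ x‖ ^ 2 + (s x)⁻¹ * ‖m x‖ ^ 2) with hE
  have hE0 : 0 ≤ E := integral_energy_nonneg B
  have hEne : E ≠ 0 := fun h0 => by
    obtain ⟨x, hx, hx'⟩ := hu
    exact hx' (H.eq_zero_of_energy B h0 x hx)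
  have e : z * N = E := by
    rw [hE, ← H.energy B, hN, ← intervalIntegral.integral_ofReal,
      ← intervalIntegral.integral_const_mul]
    refine intervalIntegral.integral_congr fun x _ => ?_
    simp only [mul_assoc, Complex.mul_conj, Complex.normSq_eq_norm_sq]
    push_cast
    ring
  refine ⟨E / N, div_pos (hE0.lt_of_ne' hEne) hNpos, ?_⟩
  rw [Complex.ofReal_div, ← e, mul_div_cancel_right₀ _ (Complex.ofReal_ne_zero.2 hNpos.ne')]

end ClampedSol

/-- Grönwall's inequality, integrated backwards from the right end point. -/
lemma nonpos_of_le_integral (hℓ : 0 < ℓ) {N : ℝ → ℝ} {C : ℝ} (hN : ContinuousOn N (Icc 0 ℓ))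
    (hC : 0 ≤ C) (h : ∀ x ∈ Icc 0 ℓ, N x ≤ C * ∫ t in x..ℓ, N t) : ∀ x ∈ Icc 0 ℓ, N x ≤ 0 := by
  set P : ℝ → ℝ := IccExtend hℓ.le (domRestrict (Icc 0 ℓ) N) with hP
  have hc : Continuous P := (continuousOn_iff_continuous_domRestrict.1 hN).Icc_extend'
  have e (y : ℝ) (hy : y ∈ Icc 0 ℓ) : P y = N y := by
    rw [hP, IccExtend_of_mem _ _ hy]; rfl
  have ei (x : ℝ) (hx : x ∈ Icc 0 ℓ) : ∫ t in x..ℓ, N t = ∫ t in x..ℓ, P t := by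
    refine intervalIntegral.integral_congr fun t ht => ?_
    rw [uIcc_of_le hx.2] at ht
    exact (e t ⟨hx.1.trans ht.1, ht.2⟩).symm
  have hd (x : ℝ) : HasDerivAt (fun x => ∫ t in x..ℓ, P t) (- P x) x :=
    intervalIntegral.integral_hasDerivAt_left (hc.intervalIntegrable x ℓ)
      hc.aestronglyMeasurable.stronglyMeasurableAtFilter hc.continuousAt
  have hd' (x : ℝ) : HasDerivAt (fun x => (∫ t in x..ℓ, P t) * Real.exp (C * x))
      (- P x * Real.exp (C * x) + (∫ t in x..ℓ, P t) * (Real.exp (C * x) * (C * 1))) x :=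
    (hd x).mul (((hasDerivAt_id x).const_mul C).exp)
  have hmono : MonotoneOn (fun x => (∫ t in x..ℓ, P t) * Real.exp (C * x)) (Icc 0 ℓ) := by
    refine monotoneOn_of_deriv_nonneg (convex_Icc 0 ℓ)
      (fun x _ => (hd' x).continuousAt.continuousWithinAt)
      (fun x _ => (hd' x).differentiableAt.differentiableWithinAt) fun x hx => ?_
    rw [interior_Icc] at hx
    have hx' := Ioo_subset_Icc_self hx
    rw [(hd' x).deriv]
    have h1 := h x hx'
    rw [ei x hx', ← e x hx'] at h1
    have := mul_le_mul_of_nonneg_right h1 (Real.exp_pos (C * x)).le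
    linarith
  intro x hx
  have h1 := hmono hx (right_mem_Icc.2 hℓ.le) hx.2
  simp only [intervalIntegral.integral_same, zero_mul] at h1
  have h2 : ∫ t in x..ℓ, P t ≤ 0 := by
    by_contra h3
    exact h1.not_gt (mul_pos (not_le.1 h3) (Real.exp_pos _))
  refine (h x hx).trans ?_
  rw [ei x hx]
  exact mul_nonpos_of_nonneg_of_nonpos hC h2

lemma neg_le_of_eq_add_integral {N y f : ℝ → ℝ} {a C : ℝ} (ha : 0 ≤ a)
    (hN : ContinuousOn N (Icc 0 ℓ)) (hN0 : ∀ x ∈ Icc 0 ℓ, 0 ≤ N x) (hC : 0 ≤ C)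
    (hf : ContinuousOn f (Icc 0 ℓ)) (h : ∀ t ∈ Icc 0 ℓ, - f t ≤ C * N t)
    (hy : ∀ x ∈ Icc 0 ℓ, y x = a + ∫ t in x..ℓ, f t) :
    ∀ x ∈ Icc 0 ℓ, max (- y x) 0 ≤ C * ∫ t in x..ℓ, N t := by
  intro x hx
  have hs : Icc x ℓ ⊆ Icc 0 ℓ := Icc_subset_Icc_left hx.1
  have iN : IntervalIntegrable N volume x ℓ := (hN.mono hs).intervalIntegrable_of_Icc hx.2
  have iF : IntervalIntegrable f volume x ℓ := (hf.mono hs).intervalIntegrable_of_Icc hx.2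
  refine max_le ?_ (mul_nonneg hC (intervalIntegral.integral_nonneg hx.2 fun t ht => hN0 t (hs ht)))
  have : - ∫ t in x..ℓ, f t ≤ C * ∫ t in x..ℓ, N t := by
    rw [← intervalIntegral.integral_neg, ← intervalIntegral.integral_const_mul]
    exact intervalIntegral.integral_mono_on hx.2 iF.neg (iN.const_mul C) fun t ht => h t (hs ht)
  rw [hy x hx]
  linarith

/-- A cooperative linear system, solved backwards from `ℓ` with nonnegative data. -/
structure Cooperative (ℓ : ℝ) (r k w : ℝ → ℝ) (c : ℝ) (y₁ y₂ y₃ y₄ : ℝ → ℝ) : Prop where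
  cont₁ : ContinuousOn y₁ (Icc 0 ℓ)
  cont₂ : ContinuousOn y₂ (Icc 0 ℓ)
  cont₃ : ContinuousOn y₃ (Icc 0 ℓ)
  cont₄ : ContinuousOn y₄ (Icc 0 ℓ)
  eq₁ : ∀ x ∈ Icc 0 ℓ, y₁ x = 0 + ∫ t in x..ℓ, y₂ t
  eq₂ : ∀ x ∈ Icc 0 ℓ, y₂ x = 0 + ∫ t in x..ℓ, r t * y₃ t
  eq₃ : ∀ x ∈ Icc 0 ℓ, y₃ x = 0 + ∫ t in x..ℓ, (y₄ t + k t * y₂ t)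
  eq₄ : ∀ x ∈ Icc 0 ℓ, y₄ x = c + ∫ t in x..ℓ, w t * y₁ t

namespace Cooperative

variable {r w : ℝ → ℝ} {c : ℝ} {y₁ y₂ y₃ y₄ : ℝ → ℝ}

lemma nonneg (hℓ : 0 < ℓ) (hr : ContinuousOn r (Icc 0 ℓ)) (hk : ContinuousOn k (Icc 0 ℓ))
    (hw : ContinuousOn w (Icc 0 ℓ)) (hr0 : ∀ x ∈ Icc 0 ℓ, 0 ≤ r x) (hk0 : ∀ x ∈ Icc 0 ℓ, 0 ≤ k x)
    (hw0 : ∀ x ∈ Icc 0 ℓ, 0 ≤ w x) (hc : 0 ≤ c) (H : Cooperative ℓ r k w c y₁ y₂ y₃ y₄) :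
    ∀ x ∈ Icc 0 ℓ, 0 ≤ y₁ x ∧ 0 ≤ y₂ x ∧ 0 ≤ y₃ x ∧ 0 ≤ y₄ x := by
  obtain ⟨Cr, hCr⟩ := isCompact_Icc.exists_bound_of_continuousOn hr
  obtain ⟨Ck, hCk⟩ := isCompact_Icc.exists_bound_of_continuousOn hk
  obtain ⟨Cw, hCw⟩ := isCompact_Icc.exists_bound_of_continuousOn hw
  set C := max 1 (max Cr (max Ck Cw)) with hC
  have hC1 : 1 ≤ C := le_max_left _ _
  have bound (f : ℝ → ℝ) (D : ℝ) (hD : D ≤ C) (h : ∀ x ∈ Icc 0 ℓ, ‖f x‖ ≤ D) (x : ℝ)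
      (hx : x ∈ Icc 0 ℓ) : f x ≤ C := (le_abs_self _).trans ((h x hx).trans hD)
  have br := bound r Cr ((le_max_left _ _).trans (le_max_right _ _)) hCr
  have bk := bound k Ck ((le_max_left _ _).trans ((le_max_right _ _).trans (le_max_right _ _))) hCk
  have bw := bound w Cw ((le_max_right _ _).trans ((le_max_right _ _).trans (le_max_right _ _))) hCw
  set N : ℝ → ℝ := fun x => max (- y₁ x) 0 + max (- y₂ x) 0 + max (- y₃ x) 0 + max (- y₄ x) 0
    with hNdef
  have cm {f : ℝ → ℝ} (hf : ContinuousOn f (Icc 0 ℓ)) :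
      ContinuousOn (fun x => max (- f x) 0) (Icc 0 ℓ) := hf.neg.sup continuousOn_const
  have hN : ContinuousOn N (Icc 0 ℓ) :=
    (((cm H.cont₁).add (cm H.cont₂)).add (cm H.cont₃)).add (cm H.cont₄)
  have p1 (x : ℝ) : 0 ≤ max (- y₁ x) 0 := le_max_right _ _
  have p2 (x : ℝ) : 0 ≤ max (- y₂ x) 0 := le_max_right _ _
  have p3 (x : ℝ) : 0 ≤ max (- y₃ x) 0 := le_max_right _ _
  have p4 (x : ℝ) : 0 ≤ max (- y₄ x) 0 := le_max_right _ _
  have hN0 (x : ℝ) : 0 ≤ N x := by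
    simp only [hNdef]
    linarith [p1 x, p2 x, p3 x, p4 x]
  have hmul (a y : ℝ) (ha : 0 ≤ a) (ha' : a ≤ C) : - (a * y) ≤ C * max (- y) 0 :=
    calc - (a * y) = a * (- y) := by ring
      _ ≤ a * max (- y) 0 := mul_le_mul_of_nonneg_left (le_max_left _ _) ha
      _ ≤ C * max (- y) 0 := mul_le_mul_of_nonneg_right ha' (le_max_right _ _)
  have hCN (x a : ℝ) (ha : a ≤ N x) : C * a ≤ C * N x :=
    mul_le_mul_of_nonneg_left ha (by linarith)
  have hone (y : ℝ) : - y ≤ C * max (- y) 0 := by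
    simpa using hmul 1 y zero_le_one hC1
  have key := fun {y f : ℝ → ℝ} {a : ℝ} (ha : 0 ≤ a) =>
    neg_le_of_eq_add_integral (ℓ := ℓ) (y := y) (f := f) ha hN (fun x _ => hN0 x)
      (by linarith : 0 ≤ C)
  have k1 := key le_rfl H.cont₂ (fun t _ => (hone _).trans (hCN t _ (by
    simp only [hNdef]; linarith [p1 t, p2 t, p3 t, p4 t]))) H.eq₁
  have k2 := key le_rfl (hr.mul H.cont₃) (fun t ht => (hmul _ _ (hr0 t ht) (br t ht)).trans
    (hCN t _ (by simp only [hNdef]; linarith [p1 t, p2 t, p3 t, p4 t]))) H.eq₂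
  have k3 := key le_rfl (H.cont₄.add (hk.mul H.cont₂)) (fun t ht => by
    have a1 := hone (y₄ t)
    have a2 := hmul _ (y₂ t) (hk0 t ht) (bk t ht)
    have a3 := hCN t (max (- y₄ t) 0 + max (- y₂ t) 0) (by
      simp only [hNdef]; linarith [p1 t, p2 t, p3 t, p4 t])
    rw [mul_add] at a3
    change - (y₄ t + k t * y₂ t) ≤ _
    linarith) H.eq₃
  have k4 := key hc (hw.mul H.cont₁) (fun t ht => (hmul _ _ (hw0 t ht) (bw t ht)).trans
    (hCN t _ (by simp only [hNdef]; linarith [p1 t, p2 t, p3 t, p4 t]))) H.eq₄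
  have hle := nonpos_of_le_integral hℓ hN (by linarith : 0 ≤ 4 * C) fun x hx => by
    simp only [hNdef] at k1 k2 k3 k4 ⊢
    linarith [k1 x hx, k2 x hx, k3 x hx, k4 x hx]
  intro x hx
  have := hle x hx
  simp only [hNdef] at this
  have q1 := le_max_left (- y₁ x) 0
  have q2 := le_max_left (- y₂ x) 0
  have q3 := le_max_left (- y₃ x) 0
  have q4 := le_max_left (- y₄ x) 0
  refine ⟨?_, ?_, ?_, ?_⟩ <;> linarith [p1 x, p2 x, p3 x, p4 x]

lemma integral_pos_left {f : ℝ → ℝ} {x : ℝ} (hx : x ∈ Ico 0 ℓ) (hf : ContinuousOn f (Icc 0 ℓ))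
    (h : ∀ t ∈ Ico 0 ℓ, 0 < f t) : 0 < ∫ t in x..ℓ, f t := by
  have hs : Icc x ℓ ⊆ Icc 0 ℓ := Icc_subset_Icc_left hx.1
  exact intervalIntegral.intervalIntegral_pos_of_pos_on
    ((hf.mono hs).intervalIntegrable_of_Icc hx.2.le)
    (fun t ht => h t ⟨hx.1.trans ht.1.le, ht.2⟩) hx.2

lemma pos (hℓ : 0 < ℓ) (hr : ContinuousOn r (Icc 0 ℓ)) (hk : ContinuousOn k (Icc 0 ℓ))
    (hw : ContinuousOn w (Icc 0 ℓ)) (hr0 : ∀ x ∈ Icc 0 ℓ, 0 < r x) (hk0 : ∀ x ∈ Icc 0 ℓ, 0 ≤ k x)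
    (hw0 : ∀ x ∈ Icc 0 ℓ, 0 ≤ w x) (hc : 0 < c) (H : Cooperative ℓ r k w c y₁ y₂ y₃ y₄) :
    0 < y₁ 0 := by
  have hn := H.nonneg hℓ hr hk hw (fun x hx => (hr0 x hx).le) hk0 hw0 hc.le
  have h4 : ∀ x ∈ Icc 0 ℓ, 0 < y₄ x := fun x hx => by
    rw [H.eq₄ x hx]
    refine add_pos_of_pos_of_nonneg hc (intervalIntegral.integral_nonneg hx.2 fun t ht => ?_)
    have ht' : t ∈ Icc 0 ℓ := ⟨hx.1.trans ht.1, ht.2⟩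
    exact mul_nonneg (hw0 t ht') (hn t ht').1
  have h3 : ∀ x ∈ Ico 0 ℓ, 0 < y₃ x := fun x hx => by
    rw [H.eq₃ x (Ico_subset_Icc_self hx), zero_add]
    refine integral_pos_left hx (H.cont₄.add (hk.mul H.cont₂)) fun t ht => ?_
    have ht' := Ico_subset_Icc_self ht
    exact add_pos_of_pos_of_nonneg (h4 t ht') (mul_nonneg (hk0 t ht') (hn t ht').2.1)
  have h2 : ∀ x ∈ Ico 0 ℓ, 0 < y₂ x := fun x hx => by
    rw [H.eq₂ x (Ico_subset_Icc_self hx), zero_add]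
    exact integral_pos_left hx (hr.mul H.cont₃) fun t ht =>
      mul_pos (hr0 t (Ico_subset_Icc_self ht)) (h3 t ht)
  rw [H.eq₁ 0 (left_mem_Icc.2 hℓ.le), zero_add]
  exact integral_pos_left ⟨le_rfl, hℓ⟩ H.cont₂ h2

end Cooperative

namespace ClampedSol

variable {u u₁ m t : ℝ → ℂ}

lemma cooperative (B : Beam ℓ s k p) {a : ℝ}
    (H : ClampedSol ℓ s k (fun x => (a : ℂ) * p x * u x) u u₁ m t) (hm : m ℓ = 0) (L : ℂ →L[ℝ] ℝ) :
    Cooperative ℓ (fun x => (s x)⁻¹) k (fun x => a * p x) (- L (t ℓ)) (fun x => L (u x))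
      (fun x => - L (u₁ x)) (fun x => L (m x)) (fun x => - L (t x)) := by
  have hℓ := B.pos
  have hl : ℓ ∈ Icc 0 ℓ := right_mem_Icc.2 hℓ.le
  have key {F f : ℝ → ℂ} (hF : IsPrim ℓ F f) (x : ℝ) (hx : x ∈ Icc 0 ℓ) :
      L (F x) = L (F ℓ) - ∫ y in x..ℓ, L (f y) := by
    rw [L.intervalIntegral_comp_comm (intervalIntegrable_of_memLp hF.memLp hx hl),
      ← hF.sub_eq hx hl, map_sub]
    ring
  have hsm (b : ℝ) (y : ℂ) : L ((b : ℂ) * y) = b * L y := by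
    rw [← Complex.real_smul, map_smul, smul_eq_mul]
  have cL {F f : ℝ → ℂ} (hF : IsPrim ℓ F f) : ContinuousOn (fun x => L (F x)) (Icc 0 ℓ) :=
    L.continuous.comp_continuousOn (hF.continuousOn hℓ)
  refine ⟨cL H.prim_u, (cL H.prim_u₁).neg, cL H.prim_m, (cL H.prim_t).neg, fun x hx => ?_,
    fun x hx => ?_, fun x hx => ?_, fun x hx => ?_⟩
  · rw [key H.prim_u x hx, H.right, map_zero, intervalIntegral.integral_neg]
    ring
  · rw [key H.prim_u₁ x hx, H.right_deriv, map_zero, zero_sub, neg_neg, zero_add]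
    refine intervalIntegral.integral_congr fun y _ => ?_
    rw [div_eq_inv_mul, ← Complex.ofReal_inv, hsm]
  · rw [key H.prim_m x hx, hm, map_zero, zero_sub, zero_add, ← intervalIntegral.integral_neg]
    refine intervalIntegral.integral_congr fun y _ => ?_
    rw [map_add, hsm]
    ring
  · rw [key H.prim_t x hx, neg_sub', sub_neg_eq_add]
    congr 1
    refine intervalIntegral.integral_congr fun y _ => ?_
    rw [← Complex.ofReal_mul, hsm]

/-- An eigenfunction whose second derivative vanishes at the right end is trivial. -/
lemma eq_zero_of_right (B : Beam ℓ s k p) {a : ℝ} (ha : 0 < a)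
    (H : ClampedSol ℓ s k (fun x => (a : ℂ) * p x * u x) u u₁ m t) (hm : m ℓ = 0) :
    ∀ x ∈ Icc 0 ℓ, u x = 0 := by
  have hℓ := B.pos
  have cs : ContinuousOn (fun x => (s x)⁻¹) (Icc 0 ℓ) :=
    B.cont_s.inv₀ fun x hx => (B.s_pos x hx).ne'
  have cw : ContinuousOn (fun x => a * p x) (Icc 0 ℓ) := continuousOn_const.mul B.cont_p
  have s0 : ∀ x ∈ Icc 0 ℓ, 0 < (s x)⁻¹ := fun x hx => inv_pos.2 (B.s_pos x hx)
  have w0 : ∀ x ∈ Icc 0 ℓ, 0 ≤ a * p x := fun x hx => (mul_pos ha (B.p_pos x hx)).le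
  have h1 (L : ℂ →L[ℝ] ℝ) : 0 ≤ L (t ℓ) := by
    by_contra! hlt
    have := (H.cooperative B hm L).pos hℓ cs B.cont_k cw s0 B.k_nonneg w0 (neg_pos.2 hlt)
    simp [H.left] at this
  have h2 (L : ℂ →L[ℝ] ℝ) : L (t ℓ) = 0 := by
    refine le_antisymm ?_ (h1 L)
    simpa using h1 (-L)
  have h3 (L : ℂ →L[ℝ] ℝ) (x : ℝ) (hx : x ∈ Icc 0 ℓ) : 0 ≤ L (u x) :=
    ((H.cooperative B hm L).nonneg hℓ cs B.cont_k cw (fun x hx => (s0 x hx).le) B.k_nonneg w0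
      (by rw [h2 L, neg_zero]) x hx).1
  have h4 (L : ℂ →L[ℝ] ℝ) (x : ℝ) (hx : x ∈ Icc 0 ℓ) : L (u x) = 0 := by
    refine le_antisymm ?_ (h3 L x hx)
    simpa using h3 (-L) x hx
  intro x hx
  exact Complex.ext (h4 Complex.reCLM x hx) (h4 Complex.imCLM x hx)

end ClampedSol

section Abstract

variable {H : Type*} [NormedAddCommGroup H] [InnerProductSpace ℂ H]

/-- The operator with kernel `κ`, with values in the continuous functions. -/
def kernelOp {X : Type*} [TopologicalSpace X] [CompactSpace X] {κ : X → H} (hκ : Continuous κ) :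
    H →L[ℂ] BoundedContinuousFunction X ℂ :=
  LinearMap.mkContinuousOfExistsBound
    { toFun := fun w => BoundedContinuousFunction.mkOfCompact
        ⟨fun x => inner ℂ (κ x) w, hκ.inner continuous_const⟩
      map_add' := fun w w' => by ext x; simp
      map_smul' := fun c w => by ext x; simp } (by
    obtain ⟨C, hC⟩ := isCompact_univ.exists_bound_of_continuousOn hκ.continuousOn
    refine ⟨max C 0, fun w => (BoundedContinuousFunction.norm_le (by positivity)).2 fun x => ?_⟩
    refine (norm_inner_le_norm _ _).trans ?_
    gcongr
    exact (hC x (mem_univ x)).trans (le_max_left _ _))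

lemma kernelOp_apply {X : Type*} [TopologicalSpace X] [CompactSpace X] {κ : X → H}
    (hκ : Continuous κ) (w : H) (x : X) : kernelOp hκ w x = inner ℂ (κ x) w := rfl

lemma isCompactOperator_kernelOp {X : Type*} [TopologicalSpace X] [CompactSpace X] {κ : X → H}
    (hκ : Continuous κ) : IsCompactOperator (kernelOp hκ) := by
  refine (isCompactOperator_iff_isCompact_closure_image_closedBall
    (kernelOp hκ : H →ₗ[ℂ] BoundedContinuousFunction X ℂ) one_pos).2 ?_
  refine BoundedContinuousFunction.arzela_ascoli (Metric.closedBall 0 ‖kernelOp hκ‖)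
    (isCompact_closedBall _ _) _ ?_ ?_
  · rintro _ x ⟨w, hw, rfl⟩
    rw [mem_closedBall_zero_iff] at hw ⊢
    refine (BoundedContinuousFunction.norm_coe_le_norm _ x).trans ?_
    exact (kernelOp hκ).unit_le_opNorm w hw
  · intro x₀
    rw [Metric.equicontinuousAt_iff_right]
    intro ε hε
    have : ∀ᶠ x in nhds x₀, dist (κ x) (κ x₀) < ε := hκ.continuousAt.eventually
      (Metric.ball_mem_nhds _ hε)
    filter_upwards [this] with x hx
    rintro ⟨_, w, hw, rfl⟩
    rw [mem_closedBall_zero_iff] at hw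
    change dist (inner ℂ (κ x₀) w) (inner ℂ (κ x) w) < ε
    rw [dist_comm, dist_eq_norm, ← inner_sub_left]
    rw [dist_eq_norm] at hx
    calc _ ≤ ‖κ x - κ x₀‖ * ‖w‖ := norm_inner_le_norm _ _
      _ ≤ ‖κ x - κ x₀‖ * 1 := by gcongr
      _ < ε := by rwa [mul_one]

open ContinuousLinearMap in
/-- Solution operator of the variational problem
`⟪v, D w⟫ + ⟪V v, K V w⟫ = ⟪V V v, Q g⟫` for `v, w` orthogonal to `e` and `V† e`. -/
lemma exists_solution_operator [CompleteSpace H] (V D K Q : H →L[ℂ] H) (e : H)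
    (hV : IsCompactOperator V) (hD : D.IsSymmetric) (hK : K.IsSymmetric)
    (hQ : Q.IsSymmetric) {c : ℝ} (hc : 0 < c) (hDc : ∀ w, c * ‖w‖ ^ 2 ≤ (inner ℂ (D w) w).re)
    (hK0 : ∀ w, 0 ≤ (inner ℂ (K w) w).re) :
    ∃ R A : H →L[ℂ] H, (∀ g, A g = Q (V (V (R g)))) ∧ A.IsSymmetric ∧
      IsCompactOperator A ∧ (∀ g, inner ℂ e (R g) = 0) ∧ (∀ g, inner ℂ e (V (R g)) = 0) ∧
      ∀ g, ∃ α β : ℂ, D (R g) + adjoint V (K (V (R g))) - adjoint V (adjoint V (Q g)) =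
        α • e + β • adjoint V e := by
  set U : Submodule ℂ H := Submodule.span ℂ {e, adjoint V e} with hU
  have : FiniteDimensional ℂ U := FiniteDimensional.span_of_finite ℂ (by simp)
  set N : H →L[ℂ] H := D + adjoint V ∘L K ∘L V with hN
  have hNs : ∀ x y, inner ℂ (N x) y = inner ℂ x (N y) := fun x y => by
    simp only [hN, add_apply, comp_apply, inner_add_left, inner_add_right,
      adjoint_inner_left, adjoint_inner_right]
    rw [show inner ℂ (D x) y = inner ℂ x (D y) from hD x y,
      show inner ℂ (K (V x)) (V y) = inner ℂ (V x) (K (V y)) from hK (V x) (V y)]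
  have hNc : ∀ w, c * ‖w‖ ^ 2 ≤ (inner ℂ (N w) w).re := fun w => by
    simp only [hN, add_apply, comp_apply, inner_add_left, adjoint_inner_left, Complex.add_re]
    linarith [hDc w, hK0 (V w)]
  set ι : Uᗮ →L[ℂ] H := Uᗮ.subtypeL with hι
  set S : Uᗮ →L[ℂ] Uᗮ := adjoint ι ∘L N ∘L ι with hS
  have hSs : ∀ x y, inner ℂ (S x) y = inner ℂ x (S y) := fun x y => by
    simp only [hS, comp_apply, adjoint_inner_left, adjoint_inner_right, hNs]
  have hSu : IsUnit S := by
    refine isUnit_of_forall_le_norm_inner_map S (c := ⟨c, hc.le⟩) hc fun x => ?_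
    have h1 : inner ℂ (S x) x = inner ℂ (N (ι x)) (ι x) := by
      simp only [hS, comp_apply, adjoint_inner_left]
    rw [h1]
    have h2 := (hNc (ι x)).trans (Complex.re_le_norm _)
    rw [mul_comm]
    exact h2
  obtain ⟨S, hSS⟩ := hSu
  set S' : Uᗮ →L[ℂ] Uᗮ := ((S⁻¹ : (Uᗮ →L[ℂ] Uᗮ)ˣ) : Uᗮ →L[ℂ] Uᗮ)
  have hSS' (x : Uᗮ) : adjoint ι (N (ι (S' x))) = x := by
    have := congrArg (fun T : Uᗮ →L[ℂ] Uᗮ => T x) S.mul_inv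
    rw [hSS] at this
    exact this
  have hS's : ∀ x y, inner ℂ (S' x) y = inner ℂ x (S' y) := fun x y => by
    conv_lhs => rw [← hSS' y]
    conv_rhs => rw [← hSS' x]
    exact (hSs (S' x) (S' y)).symm
  set R : H →L[ℂ] H := ι ∘L S' ∘L adjoint ι ∘L adjoint V ∘L adjoint V ∘L Q with hR
  have hRU (g : H) : R g ∈ Uᗮ := (S' (adjoint ι (adjoint V (adjoint V (Q g))))).2
  refine ⟨R, (Q ∘L V) ∘L V ∘L R, fun g => rfl, fun g h => ?_, ?_, fun g => ?_, fun g => ?_,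
    fun g => ?_⟩
  · change inner ℂ (Q (V (V (R g)))) h = inner ℂ g (Q (V (V (R h))))
    rw [show inner ℂ (Q (V (V (R g)))) h = inner ℂ (V (V (R g))) (Q h) from hQ _ _,
      ← show inner ℂ (Q g) (V (V (R h))) = inner ℂ g (Q (V (V (R h)))) from hQ _ _,
      ← adjoint_inner_right V (V (R g)), ← adjoint_inner_right V (R g),
      ← adjoint_inner_left V (V (R h)), ← adjoint_inner_left V (R h)]
    simp only [hR, comp_apply]
    rw [← adjoint_inner_right ι, ← adjoint_inner_left ι, hS's]
  · exact (hV.comp_clm R).clm_comp (Q ∘L V)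
  · exact (Submodule.mem_orthogonal U _).1 (hRU g) e (Submodule.subset_span (by simp))
  · rw [← adjoint_inner_left]
    exact (Submodule.mem_orthogonal U _).1 (hRU g) _ (Submodule.subset_span (by simp))
  · have hmem : N (R g) - adjoint V (adjoint V (Q g)) ∈ Uᗮᗮ := by
      rw [Submodule.mem_orthogonal]
      intro v hv
      have h1 := congrArg (fun x => inner ℂ (⟨v, hv⟩ : Uᗮ) x)
        (hSS' (adjoint ι (adjoint V (adjoint V (Q g)))))
      simp only [adjoint_inner_right ι] at h1
      rw [inner_sub_right, sub_eq_zero]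
      exact h1
    rw [Submodule.orthogonal_orthogonal, hU, Submodule.mem_span_pair] at hmem
    obtain ⟨α, β, h⟩ := hmem
    exact ⟨α, β, by rw [h]; rfl⟩

end Abstract

/-- The unweighted space `L²(0,ℓ)`. -/
abbrev L2 (ℓ : ℝ) : Type := Lp ℂ 2 (volume.restrict (Ioo 0 ℓ))

lemma L2.inner_eq (hℓ : 0 < ℓ) {f g : L2 ℓ} {f' g' : ℝ → ℂ}
    (hf : f =ᵐ[volume.restrict (Ioo 0 ℓ)] f') (hg : g =ᵐ[volume.restrict (Ioo 0 ℓ)] g') :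
    inner ℂ f g = ∫ x in (0 : ℝ)..ℓ, (starRingEnd ℂ) (f' x) * g' x := by
  rw [MeasureTheory.L2.inner_def, ← integral_Ioo_eq hℓ]
  refine integral_congr_ae ?_
  filter_upwards [hf, hg] with x hx hx'
  rw [hx, hx', RCLike.inner_apply, mul_comm]

/-- Multiplication by a real function that is continuous on `[0,ℓ]`. -/
def mulOp {a : ℝ → ℝ} (ha : ContinuousOn a (Icc 0 ℓ)) : L2 ℓ →L[ℂ] L2 ℓ :=
  LinearMap.mkContinuousOfExistsBound
    { toFun := fun f => (memLp_continuousOn_mul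
        (Complex.continuous_ofReal.comp_continuousOn ha) (Lp.memLp f)).toLp _
      map_add' := fun f g => by
        rw [← MemLp.toLp_add]
        refine MemLp.toLp_congr _ _ ?_
        filter_upwards [Lp.coeFn_add f g] with x hx
        rw [hx, Pi.add_apply, Pi.add_apply, mul_add]
      map_smul' := fun c f => by
        rw [← MemLp.toLp_const_smul]
        refine MemLp.toLp_congr _ _ ?_
        filter_upwards [Lp.coeFn_smul c f] with x hx
        simp [hx, mul_left_comm] } (by
    obtain ⟨C, hC⟩ := isCompact_Icc.exists_bound_of_continuousOn ha
    refine ⟨C, fun f => Lp.norm_le_mul_norm_of_ae_le_mul ?_⟩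
    filter_upwards [MemLp.coeFn_toLp (memLp_continuousOn_mul
      (Complex.continuous_ofReal.comp_continuousOn ha) (Lp.memLp f)),
      ae_restrict_mem measurableSet_Ioo] with x hx hx'
    refine le_of_eq_of_le (congrArg norm hx) ?_
    rw [norm_mul]
    gcongr
    simpa using hC x (Ioo_subset_Icc_self hx'))

lemma coeFn_mulOp {a : ℝ → ℝ} (ha : ContinuousOn a (Icc 0 ℓ)) (f : L2 ℓ) :
    mulOp ha f =ᵐ[volume.restrict (Ioo 0 ℓ)] fun x => a x * f x :=
  MemLp.coeFn_toLp (memLp_continuousOn_mul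
    (Complex.continuous_ofReal.comp_continuousOn ha) (Lp.memLp f))

lemma isSymmetric_mulOp (hℓ : 0 < ℓ) {a : ℝ → ℝ} (ha : ContinuousOn a (Icc 0 ℓ)) :
    (mulOp ha).IsSymmetric := fun f g => by
  change inner ℂ (mulOp ha f) g = inner ℂ f (mulOp ha g)
  rw [L2.inner_eq hℓ (coeFn_mulOp ha f) Filter.EventuallyEq.rfl,
    L2.inner_eq hℓ Filter.EventuallyEq.rfl (coeFn_mulOp ha g)]
  refine intervalIntegral.integral_congr fun x _ => ?_
  simp only [map_mul, Complex.conj_ofReal]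
  ring

lemma mulOp_coercive {a : ℝ → ℝ} (ha : ContinuousOn a (Icc 0 ℓ)) {c : ℝ}
    (hc : ∀ x ∈ Icc 0 ℓ, c ≤ a x) (f : L2 ℓ) : c * ‖f‖ ^ 2 ≤ (inner ℂ (mulOp ha f) f).re := by
  have i1 : Integrable (fun x => a x * ‖f x‖ ^ 2) (volume.restrict (Ioo 0 ℓ)) := by
    have := (MeasureTheory.L2.integrable_inner (𝕜 := ℂ) (mulOp ha f) f).re
    refine this.congr ?_
    filter_upwards [coeFn_mulOp ha f] with x hx
    rw [hx, RCLike.inner_apply, (starRingEnd ℂ).map_mul, Complex.conj_ofReal, mul_left_comm,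
      Complex.mul_conj, Complex.normSq_eq_norm_sq, ← Complex.ofReal_mul]
    rfl
  have e1 : (inner ℂ (mulOp ha f) f).re = ∫ x in Ioo 0 ℓ, a x * ‖f x‖ ^ 2 := by
    rw [MeasureTheory.L2.inner_def, ← Complex.ofReal_re (∫ x in Ioo 0 ℓ, a x * ‖f x‖ ^ 2),
      ← integral_complex_ofReal]
    congr 1
    refine integral_congr_ae ?_
    filter_upwards [coeFn_mulOp ha f] with x hx
    rw [hx, RCLike.inner_apply, map_mul, Complex.conj_ofReal, mul_left_comm, Complex.mul_conj,
      Complex.normSq_eq_norm_sq, ← Complex.ofReal_mul]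
  have i2 : Integrable (fun x => ‖f x‖ ^ 2) (volume.restrict (Ioo 0 ℓ)) :=
    (Lp.memLp f).integrable_norm_pow (by norm_num)
  have e2 : ‖f‖ ^ 2 = ∫ x in Ioo 0 ℓ, ‖f x‖ ^ 2 := by
    have h := inner_self_eq_norm_sq_to_K (𝕜 := ℂ) f
    rw [← Complex.ofReal_inj, ← integral_complex_ofReal, Complex.ofReal_pow]
    refine h.symm.trans ?_
    rw [MeasureTheory.L2.inner_def]
    refine integral_congr_ae (Filter.Eventually.of_forall fun x => ?_)
    simp
  rw [e1, e2, ← integral_const_mul]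
  refine setIntegral_mono_on (i2.const_mul c) i1 measurableSet_Ioo fun x hx => ?_
  exact mul_le_mul_of_nonneg_right (hc x (Ioo_subset_Icc_self hx)) (by positivity)

/-- The class of the constant function `1`. -/
def oneL (ℓ : ℝ) : L2 ℓ := indicatorConstLp 2 MeasurableSet.univ (measure_ne_top _ _) (1 : ℂ)

lemma inner_oneL (hℓ : 0 < ℓ) (f : L2 ℓ) : inner ℂ (oneL ℓ) f = ∫ x in (0 : ℝ)..ℓ, f x := by
  rw [oneL, MeasureTheory.L2.inner_indicatorConstLp_one, setIntegral_univ, integral_Ioo_eq hℓ]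

lemma coeFn_oneL : oneL ℓ =ᵐ[volume.restrict (Ioo 0 ℓ)] fun _ => 1 := by
  filter_upwards [indicatorConstLp_coeFn (p := 2) (μ := volume.restrict (Ioo 0 ℓ))
    (hs := MeasurableSet.univ) (hμs := measure_ne_top _ _) (c := (1 : ℂ))] with x hx
  rw [oneL, hx, indicator_univ]

lemma continuous_indicator_Ioo : Continuous fun x : Icc 0 ℓ =>
    (indicatorConstLp 2 (measurableSet_Ioo (a := 0) (b := (x : ℝ))) (measure_ne_top _ _) (1 : ℂ) :
      L2 ℓ) := by
  refine continuous_indicatorConstLp_set (by norm_num) fun x => ?_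
  have h1 : Filter.Tendsto (fun y : Icc 0 ℓ => ENNReal.ofReal |(y : ℝ) - x|) (nhds x) (nhds 0) := by
    have : Continuous fun y : Icc 0 ℓ => ENNReal.ofReal |(y : ℝ) - x| :=
      ENNReal.continuous_ofReal.comp (continuous_subtype_val.sub continuous_const).abs
    simpa using this.tendsto x
  refine tendsto_of_tendsto_of_tendsto_of_le_of_le tendsto_const_nhds h1 (fun _ => zero_le)
    fun y => ?_
  calc _ ≤ volume (symmDiff (Ioo 0 (y : ℝ)) (Ioo 0 (x : ℝ))) := Measure.restrict_apply_le _ _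
    _ ≤ volume (uIcc (x : ℝ) y) := measure_mono fun t ht => by
      rcases ht with ⟨h1, h2⟩ | ⟨h1, h2⟩
      · exact mem_uIcc.2 (Or.inl ⟨not_lt.1 fun h => h2 ⟨h1.1, h⟩, h1.2.le⟩)
      · exact mem_uIcc.2 (Or.inr ⟨not_lt.1 fun h => h2 ⟨h1.1, h⟩, h1.2.le⟩)
    _ = _ := Real.volume_interval

/-- The embedding of the continuous functions into `L²(0,ℓ)`. -/
def embed (hℓ : 0 < ℓ) : BoundedContinuousFunction (Icc 0 ℓ) ℂ →L[ℂ] L2 ℓ :=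
  LinearMap.mkContinuousOfExistsBound
    { toFun := fun f => (memLp_of_continuousOn
        (f.continuous.Icc_extend' (h := hℓ.le)).continuousOn).toLp (IccExtend hℓ.le f)
      map_add' := fun _ _ => rfl
      map_smul' := fun _ _ => rfl } (by
    refine ⟨_, fun f => Lp.norm_le_of_ae_bound (norm_nonneg f) ?_⟩
    filter_upwards [MemLp.coeFn_toLp (memLp_of_continuousOn (p := 2)
        (f.continuous.Icc_extend' (h := hℓ.le)).continuousOn)] with x hx
    refine le_of_eq_of_le (congrArg norm hx) ?_
    exact f.norm_coe_le_norm _)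

lemma coeFn_embed (hℓ : 0 < ℓ) (f : BoundedContinuousFunction (Icc 0 ℓ) ℂ) :
    embed hℓ f =ᵐ[volume.restrict (Ioo 0 ℓ)] IccExtend hℓ.le f :=
  MemLp.coeFn_toLp (memLp_of_continuousOn (f.continuous.Icc_extend' (h := hℓ.le)).continuousOn)

/-- The Volterra operator `(V f)(x) = ∫₀ˣ f` on `L²(0,ℓ)`. -/
def volterra (hℓ : 0 < ℓ) : L2 ℓ →L[ℂ] L2 ℓ :=
  embed hℓ ∘L kernelOp continuous_indicator_Ioo

lemma isCompactOperator_volterra (hℓ : 0 < ℓ) : IsCompactOperator (volterra hℓ) :=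
  (isCompactOperator_kernelOp continuous_indicator_Ioo).clm_comp (embed hℓ)

lemma coeFn_volterra (hℓ : 0 < ℓ) (f : L2 ℓ) :
    volterra hℓ f =ᵐ[volume.restrict (Ioo 0 ℓ)] fun x => ∫ t in 0..x, f t := by
  filter_upwards [coeFn_embed hℓ (kernelOp continuous_indicator_Ioo f),
    ae_restrict_mem measurableSet_Ioo] with x hx hx'
  have hx'' := Ioo_subset_Icc_self hx'
  rw [volterra, ContinuousLinearMap.comp_apply, hx, IccExtend_of_mem _ _ hx'', kernelOp_apply,
    MeasureTheory.L2.inner_indicatorConstLp_one, Measure.restrict_restrict measurableSet_Ioo,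
    intervalIntegral.integral_of_le hx''.1, integral_Ioc_eq_integral_Ioo,
    inter_eq_left.2 (Ioo_subset_Ioo_right hx''.2)]

lemma adjoint_volterra (hℓ : 0 < ℓ) (f : L2 ℓ) :
    ContinuousLinearMap.adjoint (volterra hℓ) f =
      inner ℂ (oneL ℓ) f • oneL ℓ - volterra hℓ f := by
  refine ext_inner_left ℂ fun g => ?_
  rw [ContinuousLinearMap.adjoint_inner_right, inner_sub_right, inner_smul_right,
    ← inner_conj_symm g, inner_oneL hℓ, inner_oneL hℓ,
    L2.inner_eq hℓ (coeFn_volterra hℓ g) Filter.EventuallyEq.rfl,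
    L2.inner_eq hℓ Filter.EventuallyEq.rfl (coeFn_volterra hℓ f)]
  have := (isPrim_integral 0 (Lp.memLp g)).conj.integral_parts hℓ (isPrim_integral 0 (Lp.memLp f))
  simp only [zero_add, intervalIntegral.integral_same, mul_zero, sub_zero] at this
  rw [mul_comm (∫ x in (0 : ℝ)..ℓ, f x), ← this]
  ring

lemma coeFn_adjoint_volterra (hℓ : 0 < ℓ) (f : L2 ℓ) :
    ContinuousLinearMap.adjoint (volterra hℓ) f =ᵐ[volume.restrict (Ioo 0 ℓ)]
      fun x => (∫ t in (0 : ℝ)..ℓ, f t) - ∫ t in 0..x, f t := by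
  rw [adjoint_volterra]
  filter_upwards [Lp.coeFn_sub (inner ℂ (oneL ℓ) f • oneL ℓ) (volterra hℓ f),
    Lp.coeFn_smul (inner ℂ (oneL ℓ) f) (oneL ℓ), coeFn_oneL (ℓ := ℓ), coeFn_volterra hℓ f]
    with x h1 h2 h3 h4
  rw [h1, Pi.sub_apply, h2, Pi.smul_apply, h3, h4, inner_oneL hℓ]
  simp

lemma exists_beam_operator (B : Beam ℓ s k p) :
    ∃ A : L2 ℓ →L[ℂ] L2 ℓ, A.IsSymmetric ∧ IsCompactOperator A ∧
      ∀ g : L2 ℓ, ∃ u u₁ m t, ClampedSol ℓ s k (fun x => (√(p x) : ℂ) * g x) u u₁ m t ∧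
        A g =ᵐ[volume.restrict (Ioo 0 ℓ)] fun x => (√(p x) : ℂ) * u x := by
  have hℓ := B.pos
  have cq : ContinuousOn (fun x => √(p x)) (Icc 0 ℓ) := B.cont_p.sqrt
  obtain ⟨x₀, hx₀, hmin⟩ := isCompact_Icc.exists_isMinOn (nonempty_Icc.2 hℓ.le) B.cont_s
  obtain ⟨R, A, hA, hsym, hcomp, h1, h2, hR⟩ := exists_solution_operator (volterra hℓ)
    (mulOp B.cont_s) (mulOp B.cont_k) (mulOp cq) (oneL ℓ) (isCompactOperator_volterra hℓ)
    (isSymmetric_mulOp hℓ _) (isSymmetric_mulOp hℓ _) (isSymmetric_mulOp hℓ _) (B.s_pos x₀ hx₀)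
    (fun w => mulOp_coercive B.cont_s hmin w)
    (fun w => by simpa using mulOp_coercive B.cont_k B.k_nonneg w)
  refine ⟨A, hsym, hcomp, fun g => ?_⟩
  obtain ⟨α, β, hαβ⟩ := hR g
  set V := volterra hℓ with hV
  set w : L2 ℓ := R g with hw
  set u₁ : ℝ → ℂ := fun x => ∫ t in 0..x, w t with hu₁
  have pu₁ : IsPrim ℓ u₁ w := by simpa using isPrim_integral 0 (Lp.memLp w)
  have mu₁ : MemLp u₁ 2 (volume.restrict (Ioo 0 ℓ)) := memLp_of_continuousOn (pu₁.continuousOn hℓ)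
  set u : ℝ → ℂ := fun x => ∫ t in 0..x, u₁ t with hu
  have pu : IsPrim ℓ u u₁ := by simpa using isPrim_integral 0 mu₁
  have eu₁ := coeFn_volterra hℓ w
  have eu : V (V w) =ᵐ[volume.restrict (Ioo 0 ℓ)] u := by
    filter_upwards [coeFn_volterra hℓ (V w), ae_restrict_mem measurableSet_Ioo] with x hx hx'
    rw [hx]
    have := ((isPrim_integral 0 (Lp.memLp (V w))).congr_right eu₁).eq x (Ioo_subset_Icc_self hx')
    simpa using this
  set G : L2 ℓ := mulOp cq g with hG
  have eG := coeFn_mulOp cq g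
  set t : ℝ → ℂ := fun x => - (β + ((∫ y in (0 : ℝ)..ℓ, G y) - ∫ y in 0..x, G y)) with ht
  have pt : IsPrim ℓ t (fun x => (√(p x) : ℂ) * g x) := by
    have := (isPrim_integral (- β - ∫ y in (0 : ℝ)..ℓ, G y) (Lp.memLp G)).congr_right eG
    refine this.congr_left fun x _ => ?_
    simp only [ht]
    ring
  set Z : L2 ℓ := β • oneL ℓ + (ContinuousLinearMap.adjoint V) G - mulOp B.cont_k (V w) with hZ
  have eZ : Z =ᵐ[volume.restrict (Ioo 0 ℓ)] fun x => - (t x + k x * u₁ x) := by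
    filter_upwards [Lp.coeFn_sub (β • oneL ℓ + (ContinuousLinearMap.adjoint V) G)
      (mulOp B.cont_k (V w)), Lp.coeFn_add (β • oneL ℓ) ((ContinuousLinearMap.adjoint V) G),
      Lp.coeFn_smul β (oneL ℓ), coeFn_oneL (ℓ := ℓ), coeFn_adjoint_volterra hℓ G,
      coeFn_mulOp B.cont_k (V w), eu₁] with x a1 a2 a3 a4 a5 a6 a7
    rw [hZ, a1, Pi.sub_apply, a2, Pi.add_apply, a3, Pi.smul_apply, a4, a5, a6, a7]
    simp only [ht, hu₁, smul_eq_mul]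
    ring
  set m : ℝ → ℂ := fun x => α + ((∫ y in (0 : ℝ)..ℓ, Z y) - ∫ y in 0..x, Z y) with hm
  have pm : IsPrim ℓ m (fun x => t x + k x * u₁ x) := by
    have := ((isPrim_integral 0 (Lp.memLp Z)).neg.congr_right
      (g := fun x => t x + k x * u₁ x) (by filter_upwards [eZ] with x hx; rw [hx, neg_neg]))
    have h3 := (isPrim_integral (α + ∫ y in (0 : ℝ)..ℓ, Z y)
      (f := fun _ => 0) MemLp.zero).add this
    refine (h3.congr_left fun x _ => ?_).congr_right_on fun x _ => by ring
    simp only [hm, intervalIntegral.integral_zero]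
    ring
  have key : mulOp B.cont_s w = α • oneL ℓ + (ContinuousLinearMap.adjoint V) Z := by
    rw [hZ, map_sub, map_add, map_smul]
    rw [sub_eq_iff_eq_add, ← eq_sub_iff_add_eq] at hαβ
    rw [hαβ]
    abel
  have em : (fun x => (s x : ℂ) * w x) =ᵐ[volume.restrict (Ioo 0 ℓ)] m := by
    have := coeFn_mulOp B.cont_s w
    rw [key] at this
    filter_upwards [this, Lp.coeFn_add (α • oneL ℓ) ((ContinuousLinearMap.adjoint V) Z),
      Lp.coeFn_smul α (oneL ℓ), coeFn_oneL (ℓ := ℓ), coeFn_adjoint_volterra hℓ Z]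
      with x a1 a2 a3 a4 a5
    rw [← a1, a2, Pi.add_apply, a3, Pi.smul_apply, a4, a5]
    simp only [hm, smul_eq_mul, mul_one]
  refine ⟨u, u₁, m, t, ⟨pu, pu₁.congr_right ?_, pm, pt, by simp [hu], by simp [hu₁], ?_, ?_⟩, ?_⟩
  · filter_upwards [em, ae_restrict_mem measurableSet_Ioo] with x hx hx'
    rw [← hx, mul_div_cancel_left₀ _
      (Complex.ofReal_ne_zero.2 (B.s_pos x (Ioo_subset_Icc_self hx')).ne')]
  · have := h2 g
    rw [inner_oneL hℓ, ← integral_Ioo_eq hℓ, integral_congr_ae eu₁, integral_Ioo_eq hℓ] at this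
    exact this
  · have := h1 g
    rwa [inner_oneL hℓ] at this
  · rw [hA g]
    filter_upwards [coeFn_mulOp cq (V (V w)), eu] with x hx hx'
    rw [hx, hx']

lemma not_finiteDimensional_L2 (hℓ : 0 < ℓ) : ¬ FiniteDimensional ℂ (L2 ℓ) := by
  intro hfin
  let a : ℕ → ℝ := fun n => ℓ / (n + 1)
  have ha : StrictAnti a := fun i j hij => by
    have : (i : ℝ) < j := by exact_mod_cast hij
    simp only [a]
    gcongr
  have ha0 (n : ℕ) : 0 < a n := by positivity
  have haℓ (n : ℕ) : a n ≤ ℓ := by simpa [a] using ha.antitone (Nat.zero_le n)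
  let S : ℕ → Set ℝ := fun n => Ioo (a (n + 1)) (a n)
  have hdisj (i j : ℕ) (hij : i < j) : S i ∩ S j = ∅ := by
    ext x
    simp only [S, mem_inter_iff, mem_Ioo, mem_empty_iff_false, iff_false]
    rintro ⟨⟨h1, h2⟩, h3, h4⟩
    have := ha.antitone (Nat.succ_le_of_lt hij)
    simp only [Nat.succ_eq_add_one] at this
    linarith
  let v : ℕ → L2 ℓ := fun n => indicatorConstLp 2 (s := S n) measurableSet_Ioo
    (measure_ne_top _ _) (1 : ℂ)
  have hv (i j : ℕ) : inner ℂ (v i) (v j) = ((volume.restrict (Ioo 0 ℓ)).real (S i ∩ S j) : ℂ) :=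
    MeasureTheory.L2.inner_indicatorConstLp_one_indicatorConstLp_one _ _ _ _
  have hli : LinearIndependent ℂ v := by
    refine linearIndependent_of_ne_zero_of_inner_eq_zero (fun n h0 => ?_) fun i j hij => ?_
    · have h1 := hv n n
      rw [h0, inner_zero_left, inter_self, eq_comm, Complex.ofReal_eq_zero, measureReal_def,
        Measure.restrict_apply measurableSet_Ioo, inter_eq_left.2
          (Ioo_subset_Ioo (ha0 _).le (haℓ n)), Real.volume_Ioo, ENNReal.toReal_ofReal] at h1
      · linarith [ha (Nat.lt_succ_self n)]
      · linarith [ha (Nat.lt_succ_self n)]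
    · rcases hij.lt_or_gt with h | h
      · rw [hv, hdisj i j h]; simp
      · rw [hv, inter_comm, hdisj j i h]; simp
  exact not_finite_iff_infinite.2 (inferInstance : Infinite ℕ) hli.finite

section Spectral

open Module.End

variable {H : Type*} [NormedAddCommGroup H] [InnerProductSpace ℂ H]

lemma infinite_setOf_hasEigenvalue [CompleteSpace H] {A : H →L[ℂ] H} (hA : A.IsSymmetric)
    (hc : IsCompactOperator A) (hi : ∀ x, A x = 0 → x = 0) (hinf : ¬ FiniteDimensional ℂ H) :
    {μ : ℂ | HasEigenvalue (A : Module.End ℂ H) μ}.Infinite := by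
  intro hfin
  apply hinf
  have : Finite {μ : ℂ | HasEigenvalue (A : Module.End ℂ H) μ} := hfin
  set W : Submodule ℂ H := ⨆ μ : {μ : ℂ | HasEigenvalue (A : Module.End ℂ H) μ},
    eigenspace (A : Module.End ℂ H) μ with hW
  have hfd (μ : {μ : ℂ | HasEigenvalue (A : Module.End ℂ H) μ}) :
      FiniteDimensional ℂ (eigenspace (A : Module.End ℂ H) (μ : ℂ)) := by
    refine ContinuousLinearMap.finite_dimensional_eigenspace hc _ fun h0 => ?_
    obtain ⟨x, hx⟩ := (show HasEigenvalue (A : Module.End ℂ H) (μ : ℂ) from μ.2).exists_hasEigenvector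
    refine hx.2 (hi x ?_)
    have := hx.apply_eq_smul
    rw [h0, zero_smul] at this
    exact this
  have : FiniteDimensional ℂ W := Submodule.finiteDimensional_iSup _
  have hle : (⨆ μ, eigenspace (A : Module.End ℂ H) μ) ≤ W := by
    refine iSup_le fun μ => ?_
    by_cases h : HasEigenvalue (A : Module.End ℂ H) μ
    · exact le_iSup (fun μ : {μ : ℂ | HasEigenvalue (A : Module.End ℂ H) μ} =>
        eigenspace (A : Module.End ℂ H) (μ : ℂ)) ⟨μ, h⟩
    · rw [hasEigenvalue_iff, not_not] at h
      rw [h]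
      exact bot_le
  have hbot : Wᗮ = ⊥ := by
    rw [eq_bot_iff, ← ContinuousLinearMap.orthogonalComplement_iSup_eigenspaces_eq_bot hc hA]
    exact Submodule.orthogonal_le hle
  rw [Submodule.orthogonal_eq_bot_iff] at hbot
  rw [hbot] at this
  exact Module.Finite.of_surjective (Submodule.topEquiv (R := ℂ) (M := H)).toLinearMap
    Submodule.topEquiv.surjective

lemma finite_setOf_hasEigenvalue_ge {A : H →L[ℂ] H} (hA : A.IsSymmetric)
    (hc : IsCompactOperator A) {ε : ℝ} (hε : 0 < ε) :
    {a : ℝ | ε ≤ a ∧ ∃ v ≠ 0, A v = (a : ℂ) • v}.Finite := by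
  by_contra hinf
  let f := Set.Infinite.natEmbedding _ hinf
  have hv (n : ℕ) : ∃ v : H, ‖v‖ = 1 ∧ A v = ((f n : ℝ) : ℂ) • v := by
    obtain ⟨v, hv, e⟩ := (f n).2.2
    refine ⟨((‖v‖⁻¹ : ℝ) : ℂ) • v, ?_, ?_⟩
    · rw [norm_smul, Complex.norm_real, norm_inv, norm_norm, inv_mul_cancel₀ (norm_ne_zero_iff.2 hv)]
    · rw [map_smul, e, smul_comm]
  choose v hv1 hv2 using hv
  have horth (i j : ℕ) (hij : i ≠ j) : inner ℂ (v i) (v j) = 0 := by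
    have h1 : inner ℂ (A (v i)) (v j) = inner ℂ (v i) (A (v j)) := hA _ _
    rw [hv2, hv2, inner_smul_left, inner_smul_right, Complex.conj_ofReal, ← sub_eq_zero,
      ← sub_mul, mul_eq_zero, sub_eq_zero, Complex.ofReal_inj] at h1
    exact h1.resolve_left fun h => hij (f.injective (Subtype.ext h))
  have hsep (i j : ℕ) (hij : i ≠ j) : ε ≤ dist (A (v i)) (A (v j)) := by
    have hi : ε ≤ (f i : ℝ) := (f i).2.1
    have h1 : inner ℂ (v i) (A (v i) - A (v j)) = ((f i : ℝ) : ℂ) := by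
      rw [hv2, hv2, inner_sub_right, inner_smul_right, inner_smul_right, horth i j hij,
        inner_self_eq_norm_sq_to_K, hv1]
      simp
    have h2 := norm_inner_le_norm (𝕜 := ℂ) (v i) (A (v i) - A (v j))
    rw [h1, hv1, one_mul, Complex.norm_real, ← dist_eq_norm] at h2
    exact hi.trans ((le_abs_self _).trans h2)
  have hK := (hc.isCompact_closure_image_closedBall (f := (A : H →ₗ[ℂ] H)) 1)
  obtain ⟨x, -, φ, hφ, hx⟩ := hK.tendsto_subseq (x := fun n => A (v n)) fun n =>
    subset_closure ⟨v n, by simp [hv1], rfl⟩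
  obtain ⟨N, hN⟩ := Metric.cauchySeq_iff'.1 hx.cauchySeq ε hε
  exact (hN (N + 1) (Nat.le_succ N)).not_ge (hsep _ _ (hφ (Nat.lt_succ_self N)).ne')

end Spectral

/-- An infinite set of reals that is finite below every bound is the range of a strictly
increasing sequence tending to infinity. -/
lemma exists_strictMono_range_eq {S : Set ℝ} (hinf : S.Infinite)
    (hfin : ∀ b, (S ∩ Iic b).Finite) :
    ∃ e : ℕ → ℝ, StrictMono e ∧ range e = S ∧ Filter.Tendsto e Filter.atTop Filter.atTop := by
  have hleast {T : Set ℝ} (hT : T ⊆ S) (hne : T.Nonempty) : ∃ y, IsLeast T y := by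
    obtain ⟨b, hb⟩ := hne
    obtain ⟨y, hy⟩ := ((hfin b).subset (inter_subset_inter_left _ hT)).isCompact.exists_isLeast
      ⟨b, hb, le_refl b⟩
    exact ⟨y, hy.1.1, fun z hz => (le_total z b).elim (fun h => hy.2 ⟨hz, h⟩)
      fun h => (hy.2 ⟨hb, le_refl b⟩).trans h⟩
  have hnext (x : ℝ) : ∃ y, IsLeast (S ∩ Ioi x) y := by
    refine hleast inter_subset_left ?_
    by_contra h
    refine hinf ((hfin x).subset fun y hy => ⟨hy, ?_⟩)
    by_contra h'
    exact h ⟨y, hy, mem_Ioi.2 (not_le.1 (mem_Iic.not.1 h'))⟩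
  choose next hnext using hnext
  obtain ⟨y₀, hy₀⟩ := hleast subset_rfl hinf.nonempty
  let e : ℕ → ℝ := fun n => Nat.rec y₀ (fun _ y => next y) n
  have he (n : ℕ) : IsLeast (S ∩ Ioi (e n)) (e (n + 1)) := hnext (e n)
  have hmono : StrictMono e := strictMono_nat_of_lt_succ fun n => (he n).1.2
  have hS (n : ℕ) : e n ∈ S := by
    cases n with
    | zero => exact hy₀.1
    | succ n => exact (he n).1.1
  have hunb (b : ℝ) : ∃ n, b ≤ e n := by
    by_contra h
    exact infinite_range_of_injective hmono.injective ((hfin b).subset (range_subset_iff.2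
      fun n => ⟨hS n, (not_le.1 fun h' => h ⟨n, h'⟩).le⟩))
  refine ⟨e, hmono, (range_subset_iff.2 hS).antisymm fun a ha => ?_,
    Filter.tendsto_atTop_atTop_of_monotone hmono.monotone hunb⟩
  by_contra hna
  have hlt (n : ℕ) : e n < a := by
    induction n with
    | zero => exact (hy₀.2 ha).lt_of_ne fun h => hna ⟨0, h⟩
    | succ n ih => exact ((he n).2 ⟨ha, ih⟩).lt_of_ne fun h => hna ⟨n + 1, h⟩
  obtain ⟨n, hn⟩ := hunb a
  exact hn.not_gt (hlt n)

/-- The positive numbers that are eigenvalues of the first order system. -/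
def eigenSet (ℓ : ℝ) (s k p : ℝ → ℝ) : Set ℝ :=
  {a | 0 < a ∧ ∃ u u₁ m t, ClampedSol ℓ s k (fun x => (a : ℂ) * p x * u x) u u₁ m t ∧
    ∃ x ∈ Icc 0 ℓ, u x ≠ 0}

lemma ofReal_sqrt_mul_self {a : ℝ} (ha : 0 < a) : (√a : ℂ) * (√a : ℂ) = a := by
  rw [← Complex.ofReal_mul, Real.mul_self_sqrt ha.le]

lemma eigenSet_spec (B : Beam ℓ s k p) :
    (eigenSet ℓ s k p).Infinite ∧ ∀ b, (eigenSet ℓ s k p ∩ Iic b).Finite := by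
  have hℓ := B.pos
  obtain ⟨A, hsym, hcomp, hA⟩ := exists_beam_operator B
  have hsq : ∀ x ∈ Icc 0 ℓ, (√(p x) : ℂ) ≠ 0 := fun x hx =>
    Complex.ofReal_ne_zero.2 (Real.sqrt_pos.2 (B.p_pos x hx)).ne'
  have cq : ContinuousOn (fun x => (√(p x) : ℂ)) (Icc 0 ℓ) :=
    Complex.continuous_ofReal.comp_continuousOn B.cont_p.sqrt
  have hinj (g : L2 ℓ) (hg : A g = 0) : g = 0 := by
    obtain ⟨u, u₁, m, t, H, e⟩ := hA g
    rw [hg] at e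
    have hu : EqOn u (fun _ => 0) (Icc 0 ℓ) := by
      refine eqOn_Icc_of_ae_eq (H.prim_u.continuousOn hℓ) continuousOn_const hℓ ?_
      filter_upwards [e, Lp.coeFn_zero ℂ 2 (volume.restrict (Ioo 0 ℓ)),
        ae_restrict_mem measurableSet_Ioo] with x h1 h2 h3
      rw [h2, Pi.zero_apply, eq_comm, mul_eq_zero] at h1
      exact h1.resolve_left (hsq x (Ioo_subset_Icc_self h3))
    have hu₁ : EqOn u₁ (fun _ => 0) (Icc 0 ℓ) :=
      eqOn_Icc_of_ae_eq (H.prim_u₁.continuousOn hℓ) continuousOn_const hℓ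
        (H.prim_u.ae_eq_zero hℓ hu)
    have hm : EqOn m (fun _ => 0) (Icc 0 ℓ) := by
      refine eqOn_Icc_of_ae_eq (H.prim_m.continuousOn hℓ) continuousOn_const hℓ ?_
      filter_upwards [H.prim_u₁.ae_eq_zero hℓ hu₁, ae_restrict_mem measurableSet_Ioo] with x h1 h2
      exact (div_eq_zero_iff.1 h1).resolve_right
        (Complex.ofReal_ne_zero.2 (B.s_pos x (Ioo_subset_Icc_self h2)).ne')
    have ht : EqOn t (fun _ => 0) (Icc 0 ℓ) := by
      refine eqOn_Icc_of_ae_eq (H.prim_t.continuousOn hℓ) continuousOn_const hℓ ?_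
      filter_upwards [H.prim_m.ae_eq_zero hℓ hm, ae_restrict_mem measurableSet_Ioo] with x h1 h2
      rw [hu₁ (Ioo_subset_Icc_self h2), mul_zero, add_zero] at h1
      exact h1
    rw [Lp.eq_zero_iff_ae_eq_zero]
    filter_upwards [H.prim_t.ae_eq_zero hℓ ht, ae_restrict_mem measurableSet_Ioo] with x h1 h2
    exact (mul_eq_zero.1 h1).resolve_left (hsq x (Ioo_subset_Icc_self h2))
  have hto (μ : ℂ) (hμ : Module.End.HasEigenvalue (A : Module.End ℂ (L2 ℓ)) μ) :
      ∃ a ∈ eigenSet ℓ s k p, (a : ℂ)⁻¹ = μ := by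
    obtain ⟨g, hg⟩ := hμ.exists_hasEigenvector
    have hgA : A g = μ • g := hg.apply_eq_smul
    have hμ0 : μ ≠ 0 := by
      rintro rfl
      exact hg.2 (hinj g (by rw [hgA, zero_smul]))
    obtain ⟨u, u₁, m, t, H, e⟩ := hA g
    have e' : (fun x => μ * g x) =ᵐ[volume.restrict (Ioo 0 ℓ)] fun x => (√(p x) : ℂ) * u x := by
      rw [hgA] at e
      filter_upwards [e, Lp.coeFn_smul μ g] with x h1 h2
      rw [← h1, h2, Pi.smul_apply, smul_eq_mul]
    have H' : ClampedSol ℓ s k (fun x => μ⁻¹ * p x * u x) u u₁ m t := H.congr_right (by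
      filter_upwards [e', ae_restrict_mem measurableSet_Ioo] with x h1 h2
      rw [← ofReal_sqrt_mul_self (B.p_pos x (Ioo_subset_Icc_self h2)), ← mul_assoc, mul_assoc,
        ← h1]
      field_simp)
    have hne : ∃ x ∈ Icc 0 ℓ, u x ≠ 0 := by
      by_contra! h0
      apply hg.2
      rw [Lp.eq_zero_iff_ae_eq_zero]
      filter_upwards [e', ae_restrict_mem measurableSet_Ioo] with x h1 h2
      rw [h0 x (Ioo_subset_Icc_self h2), mul_zero, mul_eq_zero] at h1
      exact h1.resolve_left hμ0
    obtain ⟨a, ha, haμ⟩ := H'.eigenvalue_pos B hne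
    rw [haμ] at H'
    exact ⟨a, ⟨ha, u, u₁, m, t, H', hne⟩, by rw [← haμ, inv_inv]⟩
  have hfrom (a : ℝ) (ha : a ∈ eigenSet ℓ s k p) : ∃ g ≠ 0, A g = ((a⁻¹ : ℝ) : ℂ) • g := by
    obtain ⟨ha0, u, u₁, m, t, H, x, hx, hux⟩ := ha
    have hac : (a : ℂ) ≠ 0 := Complex.ofReal_ne_zero.2 ha0.ne'
    have hc : ContinuousOn (fun x => (√(p x) : ℂ) * u x) (Icc 0 ℓ) :=
      cq.mul (H.prim_u.continuousOn hℓ)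
    set g : L2 ℓ := (memLp_of_continuousOn (p := 2) hc).toLp _ with hg
    have eg : g =ᵐ[volume.restrict (Ioo 0 ℓ)] fun x => (√(p x) : ℂ) * u x := MemLp.coeFn_toLp _
    refine ⟨g, fun h0 => ?_, ?_⟩
    · rw [h0] at eg
      have := eqOn_Icc_of_ae_eq hc continuousOn_const hℓ
        (eg.symm.trans (Lp.coeFn_zero ℂ 2 (volume.restrict (Ioo 0 ℓ)))) hx
      exact (mul_ne_zero (hsq x hx) hux) this
    · obtain ⟨v, v₁, n, r, H', e⟩ := hA g
      have huv := (H.const_mul (a : ℂ)⁻¹).unique B H' (by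
        filter_upwards [eg, ae_restrict_mem measurableSet_Ioo] with x h1 h2
        rw [h1, ← mul_assoc (√(p x) : ℂ), ofReal_sqrt_mul_self (B.p_pos x (Ioo_subset_Icc_self h2))]
        field_simp)
      refine Lp.ext ?_
      filter_upwards [e, eg, Lp.coeFn_smul ((a⁻¹ : ℝ) : ℂ) g, ae_restrict_mem measurableSet_Ioo]
        with x h1 h2 h3 h4
      rw [h1, h3, Pi.smul_apply, h2, ← huv x (Ioo_subset_Icc_self h4), Complex.ofReal_inv,
        smul_eq_mul, mul_left_comm]
  constructor
  · intro hfin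
    refine infinite_setOf_hasEigenvalue hsym hcomp hinj (not_finiteDimensional_L2 hℓ)
      ((hfin.image fun a : ℝ => (a : ℂ)⁻¹).subset fun μ hμ => ?_)
    obtain ⟨a, ha, e⟩ := hto μ hμ
    exact ⟨a, ha, e⟩
  · intro b
    have hf := finite_setOf_hasEigenvalue_ge hsym hcomp (ε := (max b 1)⁻¹) (by positivity)
    refine (hf.preimage (f := fun a : ℝ => a⁻¹) inv_injective.injOn).subset fun a ha => ⟨?_, ?_⟩
    · exact inv_anti₀ ha.1.1 (ha.2.trans (le_max_left _ _))
    · exact hfrom a ha.1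

section Operator

variable {σ q ρ : ℝ → ℝ}

lemma IsEigenfunction.exists_clampedSol (B : Beam ℓ s k p)
    (es : σ =ᵐ[volume.restrict (Ioo 0 ℓ)] s) (ek : q =ᵐ[volume.restrict (Ioo 0 ℓ)] k)
    (ep : ρ =ᵐ[volume.restrict (Ioo 0 ℓ)] p) {z : ℂ} {u : ℝ → ℂ}
    (h : IsEigenfunction ℓ σ q ρ z u) :
    ∃ u₁ m t, ClampedSol ℓ s k (fun x => z * p x * u x) u u₁ m t ∧
      iteratedDerivWithin 2 u (Icc 0 ℓ) ℓ = m ℓ / s ℓ := by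
  obtain ⟨u₁, m, t, H, e⟩ := h.1.exists_clampedSol B es ek
  refine ⟨u₁, m, t, H.congr_right ?_, e⟩
  filter_upwards [ep] with x hx
  rw [hx]

lemma isEigenvalue_iff (B : Beam ℓ s k p)
    (es : σ =ᵐ[volume.restrict (Ioo 0 ℓ)] s) (ek : q =ᵐ[volume.restrict (Ioo 0 ℓ)] k)
    (ep : ρ =ᵐ[volume.restrict (Ioo 0 ℓ)] p) {z : ℂ} :
    IsEigenvalue ℓ σ q ρ z ↔ ∃ a ∈ eigenSet ℓ s k p, z = (a : ℂ) := by
  constructor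
  · rintro ⟨u, hu⟩
    obtain ⟨u₁, m, t, H, -⟩ := hu.exists_clampedSol B es ek ep
    obtain ⟨a, ha, rfl⟩ := H.eigenvalue_pos B hu.2
    exact ⟨a, ⟨ha, u, u₁, m, t, H, hu.2⟩, rfl⟩
  · rintro ⟨a, ⟨-, u, u₁, m, t, H, hne⟩, rfl⟩
    refine ⟨u, (H.congr_right ?_).solvesClamped B es ek, hne⟩
    filter_upwards [ep] with x hx
    rw [hx]

lemma ae_weight (B : Beam ℓ s k p) (ep : ρ =ᵐ[volume.restrict (Ioo 0 ℓ)] p) :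
    ae (weight ℓ ρ) = ae (volume.restrict (Ioo 0 ℓ)) := by
  refine le_antisymm (withDensity_absolutelyContinuous _ _).ae_le
    (withDensity_absolutelyContinuous' ?_ ?_).ae_le
  · have : AEMeasurable p (volume.restrict (Ioo 0 ℓ)) :=
      (B.cont_p.mono Ioo_subset_Icc_self).aemeasurable measurableSet_Ioo
    exact (this.congr ep.symm).ennreal_ofReal
  · filter_upwards [ep, ae_restrict_mem measurableSet_Ioo] with x h1 h2
    rw [h1, Ne, ENNReal.ofReal_eq_zero, not_le]
    exact B.p_pos x (Ioo_subset_Icc_self h2)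

lemma memLp_weight (B : Beam ℓ s k p) (ep : ρ =ᵐ[volume.restrict (Ioo 0 ℓ)] p) {u : ℝ → ℂ}
    (hu : ContinuousOn u (Icc 0 ℓ)) : MemLp u 2 (weight ℓ ρ) := by
  have hp : Integrable p (volume.restrict (Ioo 0 ℓ)) :=
    (B.cont_p.integrableOn_Icc).mono_set Ioo_subset_Icc_self
  have : IsFiniteMeasure (weight ℓ ρ) :=
    isFiniteMeasure_withDensity_ofReal (hp.congr ep.symm).hasFiniteIntegral
  obtain ⟨C, hC⟩ := isCompact_Icc.exists_bound_of_continuousOn hu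
  refine MemLp.of_bound (((hu.mono Ioo_subset_Icc_self).aestronglyMeasurable
    measurableSet_Ioo).mono_ac (withDensity_absolutelyContinuous _ _)) C ?_
  rw [ae_weight B ep]
  exact ae_restrict_of_forall_mem measurableSet_Ioo fun x hx => hC x (Ioo_subset_Icc_self hx)

lemma mem_rootSpace_succ (B : Beam ℓ s k p)
    (es : σ =ᵐ[volume.restrict (Ioo 0 ℓ)] s) (ek : q =ᵐ[volume.restrict (Ioo 0 ℓ)] k)
    (ep : ρ =ᵐ[volume.restrict (Ioo 0 ℓ)] p) {z : ℂ} {j : ℕ} {y : L2w ℓ ρ} :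
    y ∈ rootSpace B.pos σ q ρ z (j + 1) ↔ ∃ w ∈ rootSpace B.pos σ q ρ z j, ∃ u u₁ m t,
      y =ᵐ[volume.restrict (Ioo 0 ℓ)] u ∧
      ClampedSol ℓ s k (fun x => z * p x * u x + p x * w x) u u₁ m t := by
  have hae := ae_weight B ep
  have hsum (w : L2w ℓ ρ) : (z • y + w : L2w ℓ ρ) =ᵐ[volume.restrict (Ioo 0 ℓ)]
      fun x => z * y x + w x := by
    rw [Filter.EventuallyEq, ← hae]
    filter_upwards [Lp.coeFn_add (z • y) w, Lp.coeFn_smul z y] with x h1 h2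
    rw [h1, Pi.add_apply, h2, Pi.smul_apply, smul_eq_mul]
  constructor
  · rintro ⟨w, hw, u, f, hu, hf, h⟩
    simp only [Filter.EventuallyEq, hae] at hu hf
    obtain ⟨u₁, m, t, H, -⟩ := h.exists_clampedSol B es ek
    refine ⟨w, hw, u, u₁, m, t, hu, H.congr_right ?_⟩
    filter_upwards [hu, hf, ep, hsum w] with x h1 h2 h3 h4
    rw [← h2, h4, h3, h1]
    ring
  · rintro ⟨w, hw, u, u₁, m, t, hu, H⟩
    refine ⟨w, hw, u, fun x => z * u x + w x, ?_, ?_, (H.congr_right ?_).solvesClamped B es ek⟩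
    · rw [Filter.EventuallyEq, hae]
      exact hu
    · rw [Filter.EventuallyEq, hae]
      filter_upwards [hsum w, hu] with x h1 h2
      rw [h1, h2]
    · filter_upwards [ep] with x h1
      rw [h1]
      ring

lemma mem_eigenSpace (B : Beam ℓ s k p)
    (es : σ =ᵐ[volume.restrict (Ioo 0 ℓ)] s) (ek : q =ᵐ[volume.restrict (Ioo 0 ℓ)] k)
    (ep : ρ =ᵐ[volume.restrict (Ioo 0 ℓ)] p) {z : ℂ} {y : L2w ℓ ρ} :
    y ∈ eigenSpace B.pos σ q ρ z ↔ ∃ u u₁ m t, y =ᵐ[volume.restrict (Ioo 0 ℓ)] u ∧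
      ClampedSol ℓ s k (fun x => z * p x * u x) u u₁ m t := by
  have h0 : (0 : L2w ℓ ρ) =ᵐ[volume.restrict (Ioo 0 ℓ)] 0 := by
    rw [Filter.EventuallyEq, ← ae_weight B ep]
    exact Lp.coeFn_zero _ _ _
  rw [eigenSpace, mem_rootSpace_succ B es ek ep]
  constructor
  · rintro ⟨w, hw, u, u₁, m, t, hu, H⟩
    obtain rfl : w = 0 := by simpa [rootSpace] using hw
    refine ⟨u, u₁, m, t, hu, H.congr_right ?_⟩
    filter_upwards [h0] with x hx
    rw [hx, Pi.zero_apply, mul_zero, add_zero]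
  · rintro ⟨u, u₁, m, t, hu, H⟩
    refine ⟨0, zero_mem _, u, u₁, m, t, hu, H.congr_right ?_⟩
    filter_upwards [h0] with x hx
    rw [hx, Pi.zero_apply, mul_zero, add_zero]

lemma finrank_eigenSpace (B : Beam ℓ s k p)
    (es : σ =ᵐ[volume.restrict (Ioo 0 ℓ)] s) (ek : q =ᵐ[volume.restrict (Ioo 0 ℓ)] k)
    (ep : ρ =ᵐ[volume.restrict (Ioo 0 ℓ)] p) {a : ℝ} (ha : a ∈ eigenSet ℓ s k p) :
    Module.finrank ℂ (eigenSpace B.pos σ q ρ (a : ℂ)) = 1 := by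
  have hℓ := B.pos
  have hae := ae_weight B ep
  obtain ⟨ha0, u, u₁, m, t, H, x, hx, hux⟩ := ha
  have hm : m ℓ ≠ 0 := fun h => hux (H.eq_zero_of_right B ha0 h x hx)
  have cu := H.prim_u.continuousOn hℓ
  set y : L2w ℓ ρ := (memLp_weight B ep cu).toLp u with hy
  have ey : y =ᵐ[volume.restrict (Ioo 0 ℓ)] u := by
    rw [Filter.EventuallyEq, ← hae]
    exact MemLp.coeFn_toLp _
  have hymem : y ∈ eigenSpace B.pos σ q ρ (a : ℂ) :=
    (mem_eigenSpace B es ek ep).2 ⟨u, u₁, m, t, ey, H⟩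
  have hy0 : y ≠ 0 := fun h0 => by
    have h1 := Lp.coeFn_zero ℂ 2 (weight ℓ ρ)
    rw [← h0, Filter.EventuallyEq, hae] at h1
    refine hux (eqOn_Icc_of_ae_eq cu (continuousOn_const (c := (0 : ℂ))) hℓ ?_ hx)
    filter_upwards [ey, h1] with x h2 h3
    rw [← h2, h3, Pi.zero_apply]
  refine finrank_eq_one (⟨y, hymem⟩ : eigenSpace B.pos σ q ρ (a : ℂ))
    (fun h => hy0 (congrArg Subtype.val h)) ?_
  rintro ⟨y', hy'⟩
  obtain ⟨v, v₁, n, r, ev, H'⟩ := (mem_eigenSpace B es ek ep).1 hy'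
  refine ⟨n ℓ / m ℓ, Subtype.ext ?_⟩
  have H'' := H'.sub (H.const_mul (n ℓ / m ℓ))
  have hz := (H''.congr_right (h := fun x => (a : ℂ) * p x * (v x - n ℓ / m ℓ * u x))
    (Filter.Eventually.of_forall fun x => by ring)).eq_zero_of_right B ha0 (by
      rw [div_mul_cancel₀ _ hm, sub_self])
  refine Lp.ext ?_
  have h1 := Lp.coeFn_smul (n ℓ / m ℓ) y
  rw [Filter.EventuallyEq, hae] at h1 ⊢
  filter_upwards [h1, ey, ev, ae_restrict_mem measurableSet_Ioo] with x h1 h2 h3 h4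
  refine h1.trans ?_
  rw [Pi.smul_apply, h2, h3, smul_eq_mul]
  exact (sub_eq_zero.1 (hz x (Ioo_subset_Icc_self h4))).symm

lemma rootSpace_le_eigenSpace (B : Beam ℓ s k p)
    (es : σ =ᵐ[volume.restrict (Ioo 0 ℓ)] s) (ek : q =ᵐ[volume.restrict (Ioo 0 ℓ)] k)
    (ep : ρ =ᵐ[volume.restrict (Ioo 0 ℓ)] p) (a : ℝ) (j : ℕ) :
    rootSpace B.pos σ q ρ (a : ℂ) j ≤ eigenSpace B.pos σ q ρ (a : ℂ) := by
  have hℓ := B.pos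
  induction j with
  | zero => exact bot_le
  | succ j ih =>
    intro y hy
    obtain ⟨w, hw, u, u₁, m, t, eu, H⟩ := (mem_rootSpace_succ B es ek ep).1 hy
    obtain ⟨v, v₁, n, r, ev, H'⟩ := (mem_eigenSpace B es ek ep).1 (ih hw)
    have H₁ : ClampedSol ℓ s k (fun x => (a : ℂ) * p x * u x + p x * v x) u u₁ m t :=
      H.congr_right (by filter_upwards [ev] with x hx; rw [hx])
    have hsymm := H₁.integral_mul_comm B H'.conj
    have cp : ContinuousOn (fun x => (p x : ℂ)) (Icc 0 ℓ) :=
      Complex.continuous_ofReal.comp_continuousOn B.cont_p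
    have cu := H.prim_u.continuousOn hℓ
    have cv := H'.prim_u.continuousOn hℓ
    have cvc := H'.conj.prim_u.continuousOn hℓ
    have c1 : ContinuousOn (fun x => (p x : ℂ) * v x * (starRingEnd ℂ) (v x)) (Icc 0 ℓ) :=
      (cp.mul cv).mul cvc
    have c2 : ContinuousOn (fun x => (a : ℂ) * p x * u x * (starRingEnd ℂ) (v x)) (Icc 0 ℓ) :=
      ((continuousOn_const.mul cp).mul cu).mul cvc
    have hz : ∫ x in (0 : ℝ)..ℓ, p x * ‖v x‖ ^ 2 = 0 := by
      rw [← Complex.ofReal_inj, ← intervalIntegral.integral_ofReal, Complex.ofReal_zero]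
      have e1 : ∫ x in (0 : ℝ)..ℓ, ((a : ℂ) * p x * u x + p x * v x) * (starRingEnd ℂ) (v x) =
          (∫ x in (0 : ℝ)..ℓ, (a : ℂ) * p x * u x * (starRingEnd ℂ) (v x)) +
            ∫ x in (0 : ℝ)..ℓ, (p x : ℂ) * v x * (starRingEnd ℂ) (v x) := by
        rw [← intervalIntegral.integral_add (c2.intervalIntegrable_of_Icc hℓ.le)
          (c1.intervalIntegrable_of_Icc hℓ.le)]
        exact intervalIntegral.integral_congr fun x _ => by ring
      have e2 : ∫ x in (0 : ℝ)..ℓ, (starRingEnd ℂ) ((a : ℂ) * p x * v x) * u x =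
          ∫ x in (0 : ℝ)..ℓ, (a : ℂ) * p x * u x * (starRingEnd ℂ) (v x) :=
        intervalIntegral.integral_congr fun x _ => by
          simp only [map_mul, Complex.conj_ofReal]
          ring
      rw [e1, e2, add_eq_left] at hsymm
      rw [← hsymm]
      refine intervalIntegral.integral_congr fun x _ => ?_
      simp only [mul_assoc, Complex.mul_conj, Complex.normSq_eq_norm_sq]
      push_cast
      ring
    have hv := eqOn_zero_of_integral_weight_eq_zero hℓ B.cont_p B.p_pos cv hz.le
    refine (mem_eigenSpace B es ek ep).2 ⟨u, u₁, m, t, eu, H₁.congr_right ?_⟩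
    refine ae_restrict_of_forall_mem measurableSet_Ioo fun x hx => ?_
    beta_reduce
    rw [hv x (Ioo_subset_Icc_self hx), mul_zero, add_zero]

lemma genEigenSpace_eq_eigenSpace (B : Beam ℓ s k p)
    (es : σ =ᵐ[volume.restrict (Ioo 0 ℓ)] s) (ek : q =ᵐ[volume.restrict (Ioo 0 ℓ)] k)
    (ep : ρ =ᵐ[volume.restrict (Ioo 0 ℓ)] p) (a : ℝ) :
    genEigenSpace B.pos σ q ρ (a : ℂ) = eigenSpace B.pos σ q ρ (a : ℂ) :=
  le_antisymm (iSup_le fun j => rootSpace_le_eigenSpace B es ek ep a j)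
    (le_iSup (fun j => rootSpace B.pos σ q ρ (a : ℂ) j) 1)

end Operator

end ClampedBeam

end

/-- The eigenvalues `λ₁ < λ₂ < …` are `eig 0 < eig 1 < …`. -/
theorem theorem3p1 (ℓ : ℝ) (hℓ : 0 < ℓ) (σ q ρ : ℝ → ℝ)
    (hρH : ClampedBeam.MemH ℓ 2 ρ) (hσH : ClampedBeam.MemH ℓ 2 σ) (hqH : ClampedBeam.MemH ℓ 1 q)
    (ρ₀ σ₀ : ℝ) (hρ₀ : 0 < ρ₀) (hσ₀ : 0 < σ₀)
    (hρ : ∀ x ∈ Set.Icc 0 ℓ, ρ₀ ≤ ρ x) (hσ : ∀ x ∈ Set.Icc 0 ℓ, σ₀ ≤ σ x)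
    (hq : ∀ x ∈ Set.Icc 0 ℓ, 0 ≤ q x) :
    ∃ eig : ℕ → ℝ,
      (∀ z : ℂ, ClampedBeam.IsEigenvalue ℓ σ q ρ z ↔ ∃ n, z = (eig n : ℂ)) ∧
      0 < eig 0 ∧ StrictMono eig ∧ Filter.Tendsto eig Filter.atTop Filter.atTop ∧
      (∀ n, Module.finrank ℂ (ClampedBeam.eigenSpace hℓ σ q ρ (eig n : ℂ)) = 1 ∧
        Module.finrank ℂ (ClampedBeam.genEigenSpace hℓ σ q ρ (eig n : ℂ)) = 1) ∧
      (∀ n, ∀ Φ : ℝ → ℂ, ClampedBeam.IsEigenfunction ℓ σ q ρ (eig n : ℂ) Φ →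
        iteratedDerivWithin 2 Φ (Set.Icc 0 ℓ) ℓ ≠ 0) := by
  obtain ⟨s, k, p, B, es, ek, ep⟩ :=
    ClampedBeam.exists_beam hℓ hρH hσH hqH hρ₀ hσ₀ hρ hσ hq
  obtain ⟨hinf, hfin⟩ := ClampedBeam.eigenSet_spec B
  obtain ⟨eig, hmono, hrange, htend⟩ := ClampedBeam.exists_strictMono_range_eq hinf hfin
  have hmem (n : ℕ) : eig n ∈ ClampedBeam.eigenSet ℓ s k p := hrange ▸ Set.mem_range_self n
  refine ⟨eig, fun z => ?_, (hmem 0).1, hmono, htend, fun n => ?_, fun n Φ hΦ => ?_⟩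
  · rw [ClampedBeam.isEigenvalue_iff B es ek ep, ← hrange]
    simp
  · rw [ClampedBeam.genEigenSpace_eq_eigenSpace B es ek ep]
    exact ⟨ClampedBeam.finrank_eigenSpace B es ek ep (hmem n),
      ClampedBeam.finrank_eigenSpace B es ek ep (hmem n)⟩
  · obtain ⟨u₁, m, t, H, e⟩ := hΦ.exists_clampedSol B es ek ep
    obtain ⟨x, hx, hne⟩ := hΦ.2
    rw [e]
    refine div_ne_zero (fun h => hne (H.eq_zero_of_right B (hmem n).1 h x hx)) ?_
    exact Complex.ofReal_ne_zero.2 (B.s_pos ℓ (Set.right_mem_Icc.2 hℓ.le)).ne'
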